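/- Let $\mathcal G$ be a topological groupoid: spaces of objects $O(\mathcal G)$ and morphisms $M(\mathcal G)$, with continuous source, target, identity, composition and inversion. For $k\ge 0$ let $\operatorname{Ner}_k\mathcal G$ be the space of composable chains of $k$ morphisms of $\mathcal G$ ($\operatorname{Ner}_0\mathcal G=O(\mathcal G)$). Stasheff's classifying space is the quotient space $$B\mathcal G=\coprod_{k\ge 0,\ i_0<\dots<i_k\text{ in }\mathbb N}\operatorname{Ner}_k\mathcal G\times\triangle^k\Big/\sim,$$ where a point whose barycentric coordinate at $i_j$ vanishes is identified with the point over $i_0<\dots<\widehat{i_j}<\dots<i_k$ obtained by deleting this coordinate and applying the $j$-th face map of the nerve. Let $\mathcal G^{\mathbb N}$ be the subcategory of $\mathcal G\times\mathbb N$ obtained by deleting the morphisms $(f,i\le i)$ with $f$ not an identity. A $\mathcal G$-cocycle on a space $X$ is an open cover $\{U_\alpha\}$ of $X$ with continuous maps $f_{\beta\alpha}:U_\alpha\cap U_\beta\to M(\mathcal G)$ such that $f_{\gamma\beta}\circ f_{\beta\alpha}=f_{\gamma\alpha}$ (in particular the composite is defined) on triple intersections. It is numerable if the cover admits a subordinate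 partition of unity $\{\lambda_\alpha\}$, that is, a locally finite one with $\operatorname{supp}\lambda_\alpha\subset U_\alpha$. Cocycles $\{U_\alpha;f_{\beta\alpha}\}$ and $\{V_\gamma;g_{\delta\gamma}\}$ are isomorphic if there are continuous maps $\phi_{\gamma\alpha}:U_\alpha\cap V_\gamma\to M(\mathcal G)$ with $g_{\delta\gamma}\circ\phi_{\gamma\alpha}=\phi_{\delta\beta}\circ f_{\beta\alpha}$. A numerable $\mathcal G$-structure on $X$ is an isomorphism class of numerable cocycles; two of them are homotopic if they are the restrictions to $X\times\{0\}$ and $X\times\{1\}$ of a numerable $\mathcal G$-structure on $X\times[0,1]$. Let $\mathcal G_{nu}(X)$ be the set of homotopy classes of numerable $\mathcal G$-structures on $X$, and $[X,Y]$ the set of homotopy classes of continuous maps $X\to Y$. **Theorem.** Let $\mathcal G$ be a topological groupoid. 1. Sending the class of $(c_0\to\dots\to c_k;t)$ over $i_0<\dots<i_k$ to the class of $((c_0,i_0)\to\dots\to(c_k,i_k);t)$ defines a homeomorphism from $B\mathcal G$ to the geometric realization $|\operatorname{Ner}_\cdot\mathcal G^{\mathbb N}|$. 2. For $n\in\mathbb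 N$ let $t_n:B\mathcal G\to[0,1]$ be the barycentric coordinate at $n$. The sets $U_n=t_n^{-1}((0,1])$ are the cover of a numerable $\mathcal G$-cocycle $\gamma$ on $B\mathcal G$ (the universal cocycle), whose value $\gamma_{i_li_j}$ at the class of $(c_0\to\dots\to c_k;t)$ over $i_0<\dots<i_k$ (where $t_{i_j},t_{i_l}>0$) is the composite $c_j\to\dots\to c_l$ if $j\le l$ (the identity if $j=l$), and the inverse of the composite $c_l\to\dots\to c_j$ if $l<j$. 3. For every topological space $X$ the assignment $[c]\mapsto[c^*\gamma]$ is a well-defined bijection $[X,B\mathcal G]\to\mathcal G_{nu}(X)$. For every numerable cocycle $u=\{U_\alpha;f_{\beta\alpha}\}$ on $X$ with countable index set, every enumeration of the indices by distinct natural numbers and every subordinate partition of unity $\{\lambda_\alpha\}$, the inverse bijection sends the class of $u$ to the homotopy class of the classifying map $X\to B\mathcal G$, a well-defined continuous map given by $$x\mapsto\big[f_{\alpha_1\alpha_0}(x),\dots,f_{\alpha_k\alpha_{k-1}}(x);\lambda_{\alpha_0}(x),\dots,\lambda_{\alpha_k}(x)\big],$$ where $\alpha_0,\dots,\alpha_k$,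 listed in increasing order of their numbers, are any finitely many indices with $x\in U_{\alpha_0}\cap\dots\cap U_{\alpha_k}$ and $\lambda_{\alpha_0}(x)+\dots+\lambda_{\alpha_k}(x)=1$, and the point is taken over the numbers of $\alpha_0,\dots,\alpha_k$. -/

import Mathlib

universe w u

noncomputable section

namespace StasheffClassification

/-! ### Internal categories and groupoids in topological spaces -/

/-- An internal category in topological spaces with space of objects `O` and space of
morphisms `M`; `comp g f` is `g ∘ f`, defined when the source of `g` is the target of `f`. -/
structure TopCategory (O M : Type*) [TopologicalSpace O] [TopologicalSpace M] where
  src : M → O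
  tgt : M → O
  one : O → M
  comp : (g f : M) → src g = tgt f → M
  continuous_src : Continuous src
  continuous_tgt : Continuous tgt
  continuous_one : Continuous one
  continuous_comp :
    Continuous fun p : {p : M × M // src p.1 = tgt p.2} => comp p.1.1 p.1.2 p.2
  src_one : ∀ c, src (one c) = c
  tgt_one : ∀ c, tgt (one c) = c
  src_comp : ∀ g f h, src (comp g f h) = src f
  tgt_comp : ∀ g f h, tgt (comp g f h) = tgt g
  comp_one : ∀ f, comp f (one (src f)) (tgt_one _).symm = f
  one_comp : ∀ f, comp (one (tgt f)) f (src_one _) = f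
  assoc : ∀ h g f (hg : src h = tgt g) (gf : src g = tgt f),
    comp (comp h g hg) f ((src_comp h g hg).trans gf) =
      comp h (comp g f gf) (hg.trans (tgt_comp g f gf).symm)

/-- A topological groupoid: an internal category in topological spaces with a continuous
inversion. -/
structure TopGroupoid (O M : Type*) [TopologicalSpace O] [TopologicalSpace M] extends
    TopCategory O M where
  inv : M → M
  continuous_inv : Continuous inv
  src_inv : ∀ f, src (inv f) = tgt f
  tgt_inv : ∀ f, tgt (inv f) = src f
  inv_comp : ∀ f, comp (inv f) f (src_inv f) = one (src f)
  comp_inv : ∀ f, comp f (inv f) (tgt_inv f).symm = one (tgt f)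

section Basic

variable {O M : Type*} [TopologicalSpace O] [TopologicalSpace M]

/-- `C.Composes g f h`: the composite `g ∘ f` is defined and equal to `h`. -/
def TopCategory.Composes (C : TopCategory O M) (g f h : M) : Prop :=
  ∃ e : C.src g = C.tgt f, C.comp g f e = h

namespace TopCategory

variable {C : TopCategory O M} {a b c ab bc abc f g h : M}

theorem Composes.unique {h' : M} (H : C.Composes g f h) (H' : C.Composes g f h') : h = h' := by
  obtain ⟨e, rfl⟩ := H
  obtain ⟨e', rfl⟩ := H'
  rfl

theorem Composes.assoc_left (h1 : C.Composes a b ab) (h2 : C.Composes b c bc)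
    (h3 : C.Composes a bc abc) : C.Composes ab c abc := by
  obtain ⟨e1, rfl⟩ := h1
  obtain ⟨e2, rfl⟩ := h2
  obtain ⟨e3, rfl⟩ := h3
  exact ⟨(C.src_comp _ _ _).trans e2, C.assoc _ _ _ _ _⟩

theorem Composes.assoc_right (h1 : C.Composes a b ab) (h2 : C.Composes b c bc)
    (h3 : C.Composes ab c abc) : C.Composes a bc abc := by
  obtain ⟨e1, rfl⟩ := h1
  obtain ⟨e2, rfl⟩ := h2
  obtain ⟨e3, rfl⟩ := h3
  exact ⟨e1.trans (C.tgt_comp _ _ _).symm, (C.assoc _ _ _ _ _).symm⟩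

theorem composes_one (f : M) : C.Composes f (C.one (C.src f)) f := ⟨_, C.comp_one f⟩

theorem one_composes (f : M) : C.Composes (C.one (C.tgt f)) f f := ⟨_, C.one_comp f⟩

end TopCategory

namespace TopGroupoid

variable {G : TopGroupoid O M} {f g h : M}

theorem inv_composes (f : M) : G.Composes (G.inv f) f (G.one (G.src f)) := ⟨_, G.inv_comp f⟩

theorem composes_inv (f : M) : G.Composes f (G.inv f) (G.one (G.tgt f)) := ⟨_, G.comp_inv f⟩

theorem inv_left (H : G.Composes g f h) : G.Composes (G.inv g) h f := by
  refine TopCategory.Composes.assoc_right (inv_composes g) H ?_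
  rw [H.1]
  exact G.one_composes f

theorem inv_right (H : G.Composes g f h) : G.Composes h (G.inv f) g := by
  refine TopCategory.Composes.assoc_left H (composes_inv f) ?_
  rw [← H.1]
  exact G.composes_one g

/-- An idempotent morphism of a groupoid is the identity of its source. -/
theorem eq_one_of_composes (H : G.Composes f f f) : f = G.one (G.src f) :=
  (inv_left H).unique (inv_composes f)

theorem composes_of_idem_left (H : G.Composes g g g) (hc : G.src g = G.tgt f) :
    G.Composes g f f := by
  have : g = G.one (G.tgt f) := by rw [← hc]; exact eq_one_of_composes H
  rw [this]
  exact G.one_composes f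

theorem composes_of_idem_right (H : G.Composes f f f) (hc : G.src g = G.tgt f) :
    G.Composes g f g := by
  have h1 : f = G.one (G.src g) := by
    have := eq_one_of_composes H
    rw [hc, H.1.symm]
    exact this
  rw [h1]
  exact G.composes_one g

end TopGroupoid

end Basic

/-! ### The nerve, Stasheff's classifying space and Segal's classifying space -/

section Nerve

variable {O M : Type*} [TopologicalSpace O] [TopologicalSpace M]

/-- `Ner_k C`, the space of functors from `[k] = {0 < ⋯ < k}` to `C`: families of morphisms
`F (i, j)` for `i ≤ j` with `F (i, i)` an identity and `F (j, l) ∘ F (i, j) = F (i, l)`, with the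
subspace topology. As composition is continuous, `F ↦ (F (0, 1), …, F (k - 1, k))` identifies it
for `k ≥ 1` with the iterated fibre product `M ×_O ⋯ ×_O M`, and for `k = 0` it is `O`. -/
def Nerve (C : TopCategory O M) (k : ℕ) : Type _ :=
  {F : {p : Fin (k + 1) × Fin (k + 1) // p.1 ≤ p.2} → M //
    (∀ i, ∃ c, F ⟨(i, i), le_rfl⟩ = C.one c) ∧
    ∀ i j l (hij : i ≤ j) (hjl : j ≤ l),
      C.Composes (F ⟨(j, l), hjl⟩) (F ⟨(i, j), hij⟩) (F ⟨(i, l), hij.trans hjl⟩)}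

instance (C : TopCategory O M) (k : ℕ) : TopologicalSpace (Nerve C k) :=
  instTopologicalSpaceSubtype

/-- The morphism from the `i`-th to the `j`-th vertex of a simplex of the nerve. -/
def Nerve.hom {C : TopCategory O M} {k : ℕ} (F : Nerve C k) (i j : Fin (k + 1)) (h : i ≤ j) : M :=
  F.1 ⟨(i, j), h⟩

/-- The simplicial operator `θ^* : Ner_k C → Ner_m C` of a monotone map `θ : [m] → [k]`. -/
def Nerve.restrict {C : TopCategory O M} {m k : ℕ} (F : Nerve C k)
    (θ : Fin (m + 1) →o Fin (k + 1)) : Nerve C m :=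
  ⟨fun p => F.hom (θ p.1.1) (θ p.1.2) (θ.monotone p.2),
    fun i => F.2.1 (θ i),
    fun _ _ _ hij hjl => F.2.2 _ _ _ (θ.monotone hij) (θ.monotone hjl)⟩

/-- The disjoint union of the spaces `Ner_k C × Δ^k` over all `k` and all strictly increasing
sequences `α : i₀ < ⋯ < i_k` of natural numbers. -/
abbrev PreStasheff (C : TopCategory O M) : Type _ :=
  Σ a : (Σ k : ℕ, Fin (k + 1) ↪o ℕ), Nerve C a.1 × stdSimplex ℝ (Fin (a.1 + 1))

/-- A point of `Ner_k C × Δ^k_α` whose `j`-th barycentric coordinate vanishes is identified with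
the point of `Ner_{k-1} C × Δ^{k-1}` over `α` with `i_j` omitted, obtained by applying the `j`-th
face operator of the nerve (which composes two arrows if `0 < j < k`, and drops the first or the
last arrow if `j = 0` or `j = k`) and omitting the coordinate. -/
inductive StasheffRel (C : TopCategory O M) : PreStasheff C → PreStasheff C → Prop
  | face (k : ℕ) (α : Fin (k + 2) ↪o ℕ) (F : Nerve C (k + 1)) (j : Fin (k + 2))
      (t : stdSimplex ℝ (Fin (k + 1))) :
      StasheffRel C ⟨⟨k + 1, α⟩, F, stdSimplex.map j.succAbove t⟩
        ⟨⟨k, (Fin.succAboveOrderEmb j).trans α⟩,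
          F.restrict (Fin.succAboveOrderEmb j).toOrderHom, t⟩

/-- Stasheff's classifying space `B C`, with the quotient topology. -/
def StasheffSpace (C : TopCategory O M) : Type _ := Quot (StasheffRel C)

instance (C : TopCategory O M) : TopologicalSpace (StasheffSpace C) :=
  instTopologicalSpaceQuot

/-- The class in `B C` of the point `(F, t)` of `Ner_k C × Δ^k_α`. -/
def StasheffSpace.mk {C : TopCategory O M} {k : ℕ} (α : Fin (k + 1) ↪o ℕ) (F : Nerve C k)
    (t : stdSimplex ℝ (Fin (k + 1))) : StasheffSpace C :=
  Quot.mk _ ⟨⟨k, α⟩, F, t⟩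

theorem map_succAbove_self {k : ℕ} (j : Fin (k + 2)) (t : stdSimplex ℝ (Fin (k + 1))) :
    stdSimplex.map j.succAbove t j = 0 := by
  rw [stdSimplex.map_coe, FunOnFinite.linearMap_apply_apply]
  exact Finset.sum_eq_zero fun i hi => absurd (Finset.mem_filter.1 hi).2 (Fin.succAbove_ne j i)

theorem map_succAbove_succAbove {k : ℕ} (j : Fin (k + 2)) (t : stdSimplex ℝ (Fin (k + 1)))
    (i : Fin (k + 1)) : stdSimplex.map j.succAbove t (j.succAbove i) = t i := by
  rw [stdSimplex.map_coe, FunOnFinite.linearMap_apply_apply]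
  rw [Finset.sum_eq_single i]
  · intro b hb hne
    exact absurd (Fin.succAbove_right_injective (Finset.mem_filter.1 hb).2) hne
  · intro h
    exact absurd (by simp) h

/-- The barycentric coordinate `t_n : B C → ℝ` at the vertex `n ∈ ℕ`. -/
def StasheffSpace.coord {C : TopCategory O M} (n : ℕ) : StasheffSpace C → ℝ :=
  Quot.lift (fun p => ∑ i, if p.1.2 i = n then p.2.2 i else 0) (by
    rintro _ _ ⟨k, α, F, j, t⟩
    simp only [Fin.sum_univ_succAbove _ j, map_succAbove_self, map_succAbove_succAbove]
    simp [Fin.succAboveOrderEmb]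
    rfl)

/-- The relation defining the geometric realization of the nerve:
`(x, θ_* t) ∼ (θ^* x, t)` for all monotone maps `θ : [m] → [k]`. -/
inductive RealizationRel (C : TopCategory O M) :
    (Σ k : ℕ, Nerve C k × stdSimplex ℝ (Fin (k + 1))) →
      (Σ k : ℕ, Nerve C k × stdSimplex ℝ (Fin (k + 1))) → Prop
  | op {m k : ℕ} (θ : Fin (m + 1) →o Fin (k + 1)) (F : Nerve C k)
      (t : stdSimplex ℝ (Fin (m + 1))) :
      RealizationRel C ⟨k, F, stdSimplex.map θ t⟩ ⟨m, F.restrict θ, t⟩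

/-- The geometric realization `|Ner C|` of the nerve of an internal category. -/
def Realization (C : TopCategory O M) : Type _ := Quot (RealizationRel C)

instance (C : TopCategory O M) : TopologicalSpace (Realization C) :=
  instTopologicalSpaceQuot

/-- The class in `|Ner C|` of the point `(F, t)` of `Ner_k C × Δ^k`. -/
def Realization.mk {C : TopCategory O M} {k : ℕ} (F : Nerve C k)
    (t : stdSimplex ℝ (Fin (k + 1))) : Realization C :=
  Quot.mk _ ⟨k, F, t⟩

/-- The morphisms of the unraveled category: triples `(f, i, j)` with `i ≤ j`, where `f` is an
identity if `i = j`. -/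
abbrev UnraveledMor (C : TopCategory O M) : Type _ :=
  {p : M × ℕ × ℕ // p.2.1 ≤ p.2.2 ∧ (p.2.1 = p.2.2 → ∃ c, p.1 = C.one c)}

/-- Segal's unraveled category `C^ℕ`: the subcategory of `C × ℕ` obtained by deleting the
morphisms `(f, i ≤ i)` with `f` not an identity. -/
def unraveled (C : TopCategory O M) : TopCategory (O × ℕ) (UnraveledMor C) where
  src p := (C.src p.1.1, p.1.2.1)
  tgt p := (C.tgt p.1.1, p.1.2.2)
  one c := ⟨(C.one c.1, c.2, c.2), le_rfl, fun _ => ⟨c.1, rfl⟩⟩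
  comp g f h := ⟨(C.comp g.1.1 f.1.1 (Prod.ext_iff.1 h).1, f.1.2.1, g.1.2.2),
    f.2.1.trans ((Prod.ext_iff.1 h).2.symm.le.trans g.2.1), by
      have h2 : g.1.2.1 = f.1.2.2 := (Prod.ext_iff.1 h).2
      intro h3
      have h3 : f.1.2.1 = g.1.2.2 := h3
      have hf := f.2.1
      have hg := g.2.1
      obtain ⟨c, hc⟩ := f.2.2 (by omega)
      obtain ⟨d, hd⟩ := g.2.2 (by omega)
      refine ⟨d, ?_⟩
      have h1 : C.src g.1.1 = C.tgt f.1.1 := (Prod.ext_iff.1 h).1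
      rw [hc, hd, C.src_one, C.tgt_one] at h1
      subst h1
      have := C.comp_one (C.one d)
      simp only [C.src_one] at this
      simpa only [hc, hd] using this⟩
  continuous_src := by have := C.continuous_src; fun_prop
  continuous_tgt := by have := C.continuous_tgt; fun_prop
  continuous_one := by have := C.continuous_one; fun_prop
  continuous_comp := by
    refine Continuous.subtype_mk (Continuous.prodMk ?_ (by fun_prop)) _
    exact C.continuous_comp.comp (f := fun p : {p : UnraveledMor C × UnraveledMor C //
      (C.src p.1.1.1, p.1.1.2.1) = (C.tgt p.2.1.1, p.2.1.2.2)} =>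
        (⟨(p.1.1.1.1, p.1.2.1.1), (Prod.ext_iff.1 p.2).1⟩ :
          {p : M × M // C.src p.1 = C.tgt p.2})) (by fun_prop)
  src_one c := by simp [C.src_one]
  tgt_one c := by simp [C.tgt_one]
  src_comp g f h := by simp [C.src_comp]
  tgt_comp g f h := by simp [C.tgt_comp]
  comp_one f := by
    apply Subtype.ext
    simp [C.comp_one]
  one_comp f := by
    apply Subtype.ext
    simp [C.one_comp]
  assoc h g f hg gf := by
    apply Subtype.ext
    refine Prod.ext ?_ rfl
    exact C.assoc _ _ _ _ _

/-- The simplex `(c₀, i₀) → ⋯ → (c_k, i_k)` of the nerve of the unraveled category given by a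
simplex `c₀ → ⋯ → c_k` of the nerve of `C` and natural numbers `i₀ < ⋯ < i_k`. -/
def Nerve.unravel {C : TopCategory O M} {k : ℕ} (α : Fin (k + 1) ↪o ℕ) (F : Nerve C k) :
    Nerve (unraveled C) k :=
  ⟨fun p => ⟨(F.1 p, α p.1.1, α p.1.2), α.monotone p.2, by
      obtain ⟨⟨i, j⟩, h⟩ := p
      intro h'
      obtain rfl : i = j := α.injective h'
      exact F.2.1 i⟩,
    fun i => by
      obtain ⟨c, hc⟩ := F.2.1 i
      exact ⟨(c, α i), Subtype.ext (by simp [unraveled, hc])⟩,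
    fun i j l hij hjl => by
      obtain ⟨e, he⟩ := F.2.2 i j l hij hjl
      exact ⟨Prod.ext e rfl, Subtype.ext (by simp [unraveled, he])⟩⟩

end Nerve

/-! ### Cocycles -/

section Cocycles

variable {O M : Type*} [TopologicalSpace O] [TopologicalSpace M]

/-- A `G`-cocycle on `X` indexed by `ι`: an open cover `U` and continuous maps
`f β α : U α ∩ U β → M` with `f γ β ∘ f β α = f γ α` on triple intersections. -/
structure Cocycle (G : TopGroupoid O M) (X : Type*) [TopologicalSpace X] (ι : Type*) where
  U : ι → Set X
  isOpen_U : ∀ α, IsOpen (U α)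
  cover : ∀ x, ∃ α, x ∈ U α
  f : (β α : ι) → C(↥(U α ∩ U β), M)
  comp_f : ∀ (α β γ : ι) (x : X) (hα : x ∈ U α) (hβ : x ∈ U β) (hγ : x ∈ U γ),
    G.Composes (f γ β ⟨x, hβ, hγ⟩) (f β α ⟨x, hα, hβ⟩) (f γ α ⟨x, hα, hγ⟩)

namespace Cocycle

variable {G : TopGroupoid O M} {X Y : Type*} [TopologicalSpace X] [TopologicalSpace Y]
  {ι κ μ : Type*}

/-- The cover of the cocycle admits a subordinate (locally finite) partition of unity. -/
def IsNumerable (u : Cocycle G X ι) : Prop :=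
  ∃ ρ : PartitionOfUnity ι X Set.univ, ρ.IsSubordinate u.U

/-- Isomorphism of cocycles: continuous maps `φ γ α : U α ∩ V γ → M` with
`g δ γ ∘ φ γ α = φ δ β ∘ f β α` on `U α ∩ U β ∩ V γ ∩ V δ`. -/
def Iso (u : Cocycle G X ι) (v : Cocycle G X κ) : Prop :=
  ∃ φ : (γ : κ) → (α : ι) → C(↥(u.U α ∩ v.U γ), M),
    ∀ (α β : ι) (γ δ : κ) (x : X) (hα : x ∈ u.U α) (hβ : x ∈ u.U β) (hγ : x ∈ v.U γ)
      (hδ : x ∈ v.U δ), ∃ m : M,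
        G.Composes (v.f δ γ ⟨x, hγ, hδ⟩) (φ γ α ⟨x, hα, hγ⟩) m ∧
        G.Composes (φ δ β ⟨x, hβ, hδ⟩) (u.f β α ⟨x, hα, hβ⟩) m

/-- The pullback of a cocycle along a continuous map. -/
def pullback (u : Cocycle G Y ι) (h : C(X, Y)) : Cocycle G X ι where
  U α := h ⁻¹' u.U α
  isOpen_U α := (u.isOpen_U α).preimage h.continuous
  cover x := u.cover (h x)
  f β α := ⟨fun x => u.f β α ⟨h x.1, x.2.1, x.2.2⟩, by fun_prop⟩
  comp_f α β γ x hα hβ hγ := u.comp_f α β γ (h x) hα hβ hγ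

theorem IsNumerable.pullback {u : Cocycle G Y ι} (hu : u.IsNumerable) (h : C(X, Y)) :
    (u.pullback h).IsNumerable := by
  obtain ⟨ρ, hρ⟩ := hu
  refine ⟨⟨fun i => (ρ i).comp h, ?_, ?_, ?_, ?_⟩, ?_⟩
  · exact ρ.locallyFinite.preimage_continuous h.continuous
  · intro i x
    exact ρ.nonneg i (h x)
  · intro x _
    exact ρ.sum_eq_one (Set.mem_univ (h x))
  · intro x
    exact ρ.sum_le_one (h x)
  · intro i
    refine Set.Subset.trans ?_ (Set.preimage_mono (hρ i))
    exact closure_minimal (fun x hx => subset_tsupport (ρ i) hx)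
      ((isClosed_tsupport (ρ i)).preimage h.continuous)

theorem idem (u : Cocycle G X ι) (α : ι) (x : X) (h : x ∈ u.U α) :
    G.Composes (u.f α α ⟨x, h, h⟩) (u.f α α ⟨x, h, h⟩) (u.f α α ⟨x, h, h⟩) :=
  u.comp_f α α α x h h h

/-- The one-sided compatibilities of an isomorphism of cocycles. -/
theorem iso_iff {u : Cocycle G X ι} {v : Cocycle G X κ}
    (φ : (γ : κ) → (α : ι) → C(↥(u.U α ∩ v.U γ), M)) :
    (∀ (α β : ι) (γ δ : κ) (x : X) (hα : x ∈ u.U α) (hβ : x ∈ u.U β) (hγ : x ∈ v.U γ)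
      (hδ : x ∈ v.U δ), ∃ m : M,
        G.Composes (v.f δ γ ⟨x, hγ, hδ⟩) (φ γ α ⟨x, hα, hγ⟩) m ∧
        G.Composes (φ δ β ⟨x, hβ, hδ⟩) (u.f β α ⟨x, hα, hβ⟩) m) ↔
    (∀ (α : ι) (γ δ : κ) (x : X) (hα : x ∈ u.U α) (hγ : x ∈ v.U γ) (hδ : x ∈ v.U δ),
        G.Composes (v.f δ γ ⟨x, hγ, hδ⟩) (φ γ α ⟨x, hα, hγ⟩) (φ δ α ⟨x, hα, hδ⟩)) ∧
    (∀ (α β : ι) (δ : κ) (x : X) (hα : x ∈ u.U α) (hβ : x ∈ u.U β) (hδ : x ∈ v.U δ),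
        G.Composes (φ δ β ⟨x, hβ, hδ⟩) (u.f β α ⟨x, hα, hβ⟩) (φ δ α ⟨x, hα, hδ⟩)) := by
  constructor
  · intro H
    constructor
    · intro α γ δ x hα hγ hδ
      obtain ⟨m, h1, h2⟩ := H α α γ δ x hα hα hγ hδ
      rwa [h2.unique (TopGroupoid.composes_of_idem_right (u.idem α x hα) h2.1)] at h1
    · intro α β δ x hα hβ hδ
      obtain ⟨m, h1, h2⟩ := H α β δ δ x hα hβ hδ hδ
      rwa [h1.unique (TopGroupoid.composes_of_idem_left (v.idem δ x hδ) h1.1)] at h2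
  · rintro ⟨H1, H2⟩ α β γ δ x hα hβ hγ hδ
    exact ⟨_, H1 α γ δ x hα hγ hδ, H2 α β δ x hα hβ hδ⟩

theorem Iso.refl (u : Cocycle G X ι) : u.Iso u :=
  ⟨u.f, (iso_iff u.f).2 ⟨fun α γ δ x hα hγ hδ => u.comp_f α γ δ x hα hγ hδ,
    fun α β δ x hα hβ hδ => u.comp_f α β δ x hα hβ hδ⟩⟩

theorem Iso.symm {u : Cocycle G X ι} {v : Cocycle G X κ} (h : u.Iso v) : v.Iso u := by
  obtain ⟨φ, hφ⟩ := h
  obtain ⟨h1, h2⟩ := (iso_iff φ).1 hφ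
  refine ⟨fun α γ => ⟨fun x => G.inv (φ γ α ⟨x.1, x.2.2, x.2.1⟩),
    G.continuous_inv.comp (by fun_prop)⟩, (iso_iff _).2 ⟨?_, ?_⟩⟩
  · intro γ α β x hγ hα hβ
    exact TopGroupoid.inv_right (TopGroupoid.inv_left (h2 α β γ x hα hβ hγ))
  · intro γ δ α x hγ hδ hα
    exact TopGroupoid.inv_left (TopGroupoid.inv_right (h1 α γ δ x hα hγ hδ))

theorem Iso.trans {u : Cocycle G X ι} {v : Cocycle G X κ} {w : Cocycle G X μ} (h : u.Iso v)
    (h' : v.Iso w) : u.Iso w := by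
  obtain ⟨φ, hφ⟩ := h
  obtain ⟨ψ, hψ⟩ := h'
  obtain ⟨p1, p2⟩ := (iso_iff φ).1 hφ
  obtain ⟨q1, q2⟩ := (iso_iff ψ).1 hψ
  choose c hc using v.cover
  -- the composite through the member `γ` of the middle cover
  have ex : ∀ (ε : μ) (γ : κ) (α : ι) (x : X) (hα : x ∈ u.U α) (hγ : x ∈ v.U γ)
      (hε : x ∈ w.U ε), G.src (ψ ε γ ⟨x, hγ, hε⟩) = G.tgt (φ γ α ⟨x, hα, hγ⟩) := by
    intro ε γ α x hα hγ hε
    rw [← (q2 γ γ ε x hγ hγ hε).2, G.src_comp, (p1 α γ γ x hα hγ hγ).1]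
  let r : (ε : μ) → (α : ι) → ↥(u.U α ∩ w.U ε) → M := fun ε α x =>
    G.comp (ψ ε (c x) ⟨x, hc x, x.2.2⟩) (φ (c x) α ⟨x, x.2.1, hc x⟩)
      (ex ε (c x) α x x.2.1 (hc x) x.2.2)
  have hr : ∀ (ε : μ) (γ : κ) (α : ι) (x : X) (hα : x ∈ u.U α) (hγ : x ∈ v.U γ)
      (hε : x ∈ w.U ε), G.Composes (ψ ε γ ⟨x, hγ, hε⟩) (φ γ α ⟨x, hα, hγ⟩)
        (r ε α ⟨x, hα, hε⟩) := by
    intro ε γ α x hα hγ hε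
    exact TopCategory.Composes.assoc_left (q2 γ (c x) ε x hγ (hc x) hε)
      (p1 α γ (c x) x hα hγ (hc x)) ⟨ex ε (c x) α x hα (hc x) hε, rfl⟩
  have hcont : ∀ ε α, Continuous (r ε α) := by
    intro ε α
    rw [continuous_iff_continuousAt]
    intro x
    have hopen : IsOpen {y : ↥(u.U α ∩ w.U ε) | (y : X) ∈ v.U (c x)} :=
      (v.isOpen_U _).preimage continuous_subtype_val
    refine ContinuousOn.continuousAt (s := {y : ↥(u.U α ∩ w.U ε) | (y : X) ∈ v.U (c x)}) ?_
      (hopen.mem_nhds (hc x))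
    rw [continuousOn_iff_continuous_domRestrict]
    have : Set.domRestrict {y : ↥(u.U α ∩ w.U ε) | (y : X) ∈ v.U (c x)} (r ε α) =
        (fun p : {p : M × M // G.src p.1 = G.tgt p.2} => G.comp p.1.1 p.1.2 p.2) ∘
        fun y : {y : ↥(u.U α ∩ w.U ε) | (y : X) ∈ v.U (c x)} =>
          ⟨(ψ ε (c x) ⟨y.1, y.2, y.1.2.2⟩, φ (c x) α ⟨y.1, y.1.2.1, y.2⟩),
            ex ε (c x) α y.1 y.1.2.1 y.2 y.1.2.2⟩ := by
      funext y
      exact (hr ε (c x) α y.1 y.1.2.1 y.2 y.1.2.2).2.symm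
    rw [this]
    exact G.continuous_comp.comp (by fun_prop)
  refine ⟨fun ε α => ⟨r ε α, hcont ε α⟩, (iso_iff _).2 ⟨?_, ?_⟩⟩
  · intro α ε η x hα hε hη
    exact TopCategory.Composes.assoc_right (q1 (c x) ε η x (hc x) hε hη)
      (hr ε (c x) α x hα (hc x) hε) (hr η (c x) α x hα (hc x) hη)
  · intro α β ε x hα hβ hε
    exact TopCategory.Composes.assoc_left (hr ε (c x) β x hβ (hc x) hε)
      (p2 α β (c x) x hα hβ (hc x)) (hr ε (c x) α x hα (hc x) hε)

theorem Iso.pullback {u : Cocycle G Y ι} {v : Cocycle G Y κ} (H : u.Iso v) (h : C(X, Y)) :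
    (u.pullback h).Iso (v.pullback h) := by
  obtain ⟨φ, hφ⟩ := H
  exact ⟨fun γ α => ⟨fun x => φ γ α ⟨h x.1, x.2.1, x.2.2⟩, by fun_prop⟩,
    fun α β γ δ x hα hβ hγ hδ => hφ α β γ δ (h x) hα hβ hγ hδ⟩

/-- Two cocycles `u`, `v` glued over open sets `A`, `B` with `A ∪ B = X` along an isomorphism
over `A ∩ B`. -/
def glue (u : Cocycle G X ι) (v : Cocycle G X κ) (A B : Set X) (hA : IsOpen A) (hB : IsOpen B)
    (hAB : ∀ x, x ∈ A ∨ x ∈ B)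
    (φ : (γ : κ) → (α : ι) → C(↥((u.U α ∩ A) ∩ (v.U γ ∩ B)), M))
    (h1 : ∀ α γ δ x (hα : x ∈ u.U α ∩ A) (hγ : x ∈ v.U γ ∩ B) (hδ : x ∈ v.U δ ∩ B),
      G.Composes (v.f δ γ ⟨x, hγ.1, hδ.1⟩) (φ γ α ⟨x, hα, hγ⟩) (φ δ α ⟨x, hα, hδ⟩))
    (h2 : ∀ α β δ x (hα : x ∈ u.U α ∩ A) (hβ : x ∈ u.U β ∩ A) (hδ : x ∈ v.U δ ∩ B),
      G.Composes (φ δ β ⟨x, hβ, hδ⟩) (u.f β α ⟨x, hα.1, hβ.1⟩) (φ δ α ⟨x, hα, hδ⟩)) :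
    Cocycle G X (ι ⊕ κ) where
  U := Sum.elim (fun α => u.U α ∩ A) (fun γ => v.U γ ∩ B)
  isOpen_U := by
    rintro (α | γ)
    · exact (u.isOpen_U α).inter hA
    · exact (v.isOpen_U γ).inter hB
  cover x := by
    rcases hAB x with h | h
    · obtain ⟨α, hα⟩ := u.cover x
      exact ⟨Sum.inl α, hα, h⟩
    · obtain ⟨γ, hγ⟩ := v.cover x
      exact ⟨Sum.inr γ, hγ, h⟩
  f
    | Sum.inl β, Sum.inl α => ⟨fun x => u.f β α ⟨x.1, x.2.1.1, x.2.2.1⟩, by fun_prop⟩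
    | Sum.inr δ, Sum.inr γ => ⟨fun x => v.f δ γ ⟨x.1, x.2.1.1, x.2.2.1⟩, by fun_prop⟩
    | Sum.inr γ, Sum.inl α => φ γ α
    | Sum.inl α, Sum.inr γ => ⟨fun x => G.inv (φ γ α ⟨x.1, x.2.2, x.2.1⟩),
        G.continuous_inv.comp (by fun_prop)⟩
  comp_f := by
    rintro (α | α) (β | β) (γ | γ) x hα hβ hγ
    · exact u.comp_f α β γ x hα.1 hβ.1 hγ.1
    · exact h2 α β γ x hα hβ hγ
    · exact TopGroupoid.inv_left (h2 α γ β x hα hγ hβ)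
    · exact h1 α β γ x hα hβ hγ
    · exact TopGroupoid.inv_right (TopGroupoid.inv_left (h2 β γ α x hβ hγ hα))
    · exact TopGroupoid.inv_right (h1 β α γ x hβ hα hγ)
    · exact TopGroupoid.inv_left (TopGroupoid.inv_right (h1 γ α β x hγ hα hβ))
    · exact v.comp_f α β γ x hα.1 hβ.1 hγ.1

theorem isNumerable_glue (u : Cocycle G X ι) (v : Cocycle G X κ) (hu : u.IsNumerable)
    (hv : v.IsNumerable) (A B : Set X) (hA : IsOpen A) (hB : IsOpen B)
    (hAB : ∀ x, x ∈ A ∨ x ∈ B)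
    (φ : (γ : κ) → (α : ι) → C(↥((u.U α ∩ A) ∩ (v.U γ ∩ B)), M)) (h1) (h2)
    (χ : C(X, ℝ)) (h0 : ∀ x, 0 ≤ χ x) (h01 : ∀ x, χ x ≤ 1) (hχA : tsupport χ ⊆ A)
    (hχB : tsupport (fun x => 1 - χ x) ⊆ B) :
    (glue u v A B hA hB hAB φ h1 h2).IsNumerable := by
  obtain ⟨ρ, hρ⟩ := hu
  obtain ⟨σ, hσ⟩ := hv
  have hsum : ∀ x, ∑ᶠ i : ι ⊕ κ,
      (Sum.elim (fun α => χ * ρ α) (fun γ => (1 - χ) * σ γ) i : C(X, ℝ)) x = 1 := by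
    intro x
    have f1 : (Function.support fun α => ρ α x).Finite := ρ.locallyFinite.point_finite x
    have f2 : (Function.support fun γ => σ γ x).Finite := σ.locallyFinite.point_finite x
    have key : (fun i : ι ⊕ κ =>
        (Sum.elim (fun α => χ * ρ α) (fun γ => (1 - χ) * σ γ) i : C(X, ℝ)) x) =
        Sum.elim (fun α => χ x * ρ α x) (fun γ => (1 - χ x) * σ γ x) := by
      funext i
      rcases i with i | i <;> simp
    rw [key]
    have e1 : ∑ᶠ α, χ x * ρ α x = χ x := by
      rw [← mul_finsum, ρ.sum_eq_one (Set.mem_univ x), mul_one]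
    have e2 : ∑ᶠ γ, (1 - χ x) * σ γ x = 1 - χ x := by
      rw [← mul_finsum, σ.sum_eq_one (Set.mem_univ x), mul_one]
    have g1 : (Function.support fun α => χ x * ρ α x).Finite :=
      f1.subset (fun a ha h => ha (by simp only [h, mul_zero]))
    have g2 : (Function.support fun γ => (1 - χ x) * σ γ x).Finite :=
      f2.subset (fun a ha h => ha (by simp only [h, mul_zero]))
    have s1 : (Function.support (Sum.elim (fun α => χ x * ρ α x)
        (fun γ => (1 - χ x) * σ γ x))).Finite := by
      refine ((g1.image Sum.inl).union (g2.image Sum.inr)).subset ?_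
      rintro (i | i) hi
      · exact Or.inl ⟨i, hi, rfl⟩
      · exact Or.inr ⟨i, hi, rfl⟩
    rw [finsum_eq_sum_of_support_subset (s := (g1.toFinset).disjSum g2.toFinset)]
    · rw [Finset.sum_disjSum]
      simp only [Sum.elim_inl, Sum.elim_inr]
      rw [← finsum_eq_sum _ g1, ← finsum_eq_sum _ g2, e1, e2]
      ring
    · rintro (i | i) hi
      · simpa using hi
      · simpa using hi
  refine ⟨⟨fun i => Sum.elim (fun α => χ * ρ α) (fun γ => (1 - χ) * σ γ) i, ?_, ?_, ?_, ?_⟩, ?_⟩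
  · have l1 : LocallyFinite fun α => Function.support (χ * ρ α : C(X, ℝ)) :=
      ρ.locallyFinite.subset fun α x hx h => hx (by simp [h])
    have l2 : LocallyFinite fun γ => Function.support ((1 - χ) * σ γ : C(X, ℝ)) :=
      σ.locallyFinite.subset fun α x hx h => hx (by simp [h])
    have := l1.sumElim l2
    convert this using 2 with i
    rcases i with i | i <;> rfl
  · rintro (i | i) x
    · exact mul_nonneg (h0 x) (ρ.nonneg i x)
    · exact mul_nonneg (sub_nonneg.2 (h01 x)) (σ.nonneg i x)
  · intro x _
    exact hsum x
  · intro x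
    exact (hsum x).le
  · rintro (i | i)
    · refine Set.subset_inter ?_ ?_
      · exact (closure_mono (Function.support_mul_subset_right χ (ρ i))).trans (hρ i)
      · exact (closure_mono (Function.support_mul_subset_left χ (ρ i))).trans hχA
    · refine Set.subset_inter ?_ ?_
      · exact (closure_mono (Function.support_mul_subset_right (1 - χ : C(X, ℝ)) (σ i))).trans (hσ i)
      · exact (closure_mono (Function.support_mul_subset_left (fun x => 1 - χ x) (σ i))).trans hχB

section GluePullback

variable (u : Cocycle G X ι) (v : Cocycle G X κ) (A B : Set X) (hA : IsOpen A) (hB : IsOpen B)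
  (hAB : ∀ x, x ∈ A ∨ x ∈ B)
  (φ : (γ : κ) → (α : ι) → C(↥((u.U α ∩ A) ∩ (v.U γ ∩ B)), M))
  (h1 : ∀ α γ δ x (hα : x ∈ u.U α ∩ A) (hγ : x ∈ v.U γ ∩ B) (hδ : x ∈ v.U δ ∩ B),
    G.Composes (v.f δ γ ⟨x, hγ.1, hδ.1⟩) (φ γ α ⟨x, hα, hγ⟩) (φ δ α ⟨x, hα, hδ⟩))
  (h2 : ∀ α β δ x (hα : x ∈ u.U α ∩ A) (hβ : x ∈ u.U β ∩ A) (hδ : x ∈ v.U δ ∩ B),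
    G.Composes (φ δ β ⟨x, hβ, hδ⟩) (u.f β α ⟨x, hα.1, hβ.1⟩) (φ δ α ⟨x, hα, hδ⟩))

theorem glue_pullback_left (h : C(Y, X)) (hh : ∀ y, h y ∈ A) :
    (u.pullback h).Iso ((glue u v A B hA hB hAB φ h1 h2).pullback h) := by
  refine ⟨fun i α => ⟨fun y => (glue u v A B hA hB hAB φ h1 h2).f i (Sum.inl α)
    ⟨h y.1, ⟨y.2.1, hh y⟩, y.2.2⟩, by fun_prop⟩, (iso_iff _).2 ⟨?_, ?_⟩⟩
  · intro α i j y hα hi hj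
    exact (glue u v A B hA hB hAB φ h1 h2).comp_f (Sum.inl α) i j (h y) ⟨hα, hh y⟩ hi hj
  · intro α β j y hα hβ hj
    exact (glue u v A B hA hB hAB φ h1 h2).comp_f (Sum.inl α) (Sum.inl β) j (h y) ⟨hα, hh y⟩
      ⟨hβ, hh y⟩ hj

theorem glue_pullback_right (h : C(Y, X)) (hh : ∀ y, h y ∈ B) :
    (v.pullback h).Iso ((glue u v A B hA hB hAB φ h1 h2).pullback h) := by
  refine ⟨fun i α => ⟨fun y => (glue u v A B hA hB hAB φ h1 h2).f i (Sum.inr α)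
    ⟨h y.1, ⟨y.2.1, hh y⟩, y.2.2⟩, by fun_prop⟩, (iso_iff _).2 ⟨?_, ?_⟩⟩
  · intro α i j y hα hi hj
    exact (glue u v A B hA hB hAB φ h1 h2).comp_f (Sum.inr α) i j (h y) ⟨hα, hh y⟩ hi hj
  · intro α β j y hα hβ hj
    exact (glue u v A B hA hB hAB φ h1 h2).comp_f (Sum.inr α) (Sum.inr β) j (h y) ⟨hα, hh y⟩
      ⟨hβ, hh y⟩ hj

end GluePullback

end Cocycle

/-- A numerable `G`-cocycle on `X`, with an index set in `Type w`. -/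
structure NumerableCocycle (G : TopGroupoid O M) (X : Type*) [TopologicalSpace X] where
  ι : Type w
  cocycle : Cocycle G X ι
  isNumerable : cocycle.IsNumerable

namespace NumerableCocycle

variable {G : TopGroupoid O M} {X Y Z : Type*} [TopologicalSpace X] [TopologicalSpace Y]
  [TopologicalSpace Z]

/-- Isomorphism of numerable cocycles. -/
instance isoSetoid (G : TopGroupoid O M) (X : Type*) [TopologicalSpace X] :
    Setoid (NumerableCocycle.{w} G X) where
  r u v := u.cocycle.Iso v.cocycle
  iseqv := ⟨fun u => Cocycle.Iso.refl u.cocycle, Cocycle.Iso.symm, Cocycle.Iso.trans⟩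

/-- The pullback of a numerable cocycle along a continuous map. -/
def pullback (u : NumerableCocycle.{w} G Y) (h : C(X, Y)) : NumerableCocycle.{w} G X :=
  ⟨u.ι, u.cocycle.pullback h, u.isNumerable.pullback h⟩

end NumerableCocycle

/-- The set `H¹_nu(X, G)` of numerable `G`-structures on `X`: isomorphism classes of numerable
cocycles. -/
def NumerableStructure (G : TopGroupoid O M) (X : Type*) [TopologicalSpace X] : Type _ :=
  Quotient (NumerableCocycle.isoSetoid.{w} G X)

/-- The inclusion `X → X × [0,1]`, `x ↦ (x, s)`. -/
def slice (X : Type*) [TopologicalSpace X] (s : unitInterval) : C(X, X × unitInterval) :=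
  ⟨fun x => (x, s), by fun_prop⟩

namespace NumerableStructure

variable {G : TopGroupoid O M} {X Y Z : Type*} [TopologicalSpace X] [TopologicalSpace Y]
  [TopologicalSpace Z]

/-- The pullback of a numerable `G`-structure along a continuous map. -/
def pullback (u : NumerableStructure.{w} G Y) (h : C(X, Y)) : NumerableStructure.{w} G X :=
  Quotient.map (fun u => u.pullback h) (fun _ _ H => Cocycle.Iso.pullback H h) u

theorem pullback_pullback (u : NumerableStructure.{w} G Z) (h : C(Y, Z)) (k : C(X, Y)) :
    (u.pullback h).pullback k = u.pullback (h.comp k) := by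
  induction u using Quotient.inductionOn
  rfl

theorem pullback_id (u : NumerableStructure.{w} G X) :
    u.pullback (ContinuousMap.id X) = u := by
  induction u using Quotient.inductionOn
  rfl

/-- Two numerable `G`-structures on `X` are homotopic if they are the restrictions to `X × {0}`
and `X × {1}` of a numerable `G`-structure on `X × [0,1]`. -/
def Homotopic (u v : NumerableStructure.{w} G X) : Prop :=
  ∃ W : NumerableStructure.{w} G (X × unitInterval),
    W.pullback (slice X 0) = u ∧ W.pullback (slice X 1) = v

theorem Homotopic.refl (u : NumerableStructure.{w} G X) : u.Homotopic u :=
  ⟨u.pullback ⟨Prod.fst, continuous_fst⟩,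
    (pullback_pullback _ _ _).trans (pullback_id u),
    (pullback_pullback _ _ _).trans (pullback_id u)⟩

theorem Homotopic.symm {u v : NumerableStructure.{w} G X} (H : u.Homotopic v) :
    v.Homotopic u := by
  obtain ⟨W, rfl, rfl⟩ := H
  refine ⟨W.pullback ⟨fun p => (p.1, unitInterval.symm p.2), by fun_prop⟩, ?_, ?_⟩
  · rw [pullback_pullback]
    congr 1
    ext x <;> simp [slice]
  · rw [pullback_pullback]
    congr 1
    ext x <;> simp [slice]

/-- Homotopies are concatenated by gluing over `X × [0, 2/3)` and `X × (1/3, 1]`. -/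
theorem Homotopic.trans {u v z : NumerableStructure.{w} G X} (H : u.Homotopic v)
    (H' : v.Homotopic z) : u.Homotopic z := by
  obtain ⟨W, rfl, hW⟩ := H
  obtain ⟨W', hW', rfl⟩ := H'
  induction W using Quotient.inductionOn with | _ a
  induction W' using Quotient.inductionOn with | _ b
  obtain ⟨φ, hφ⟩ : (a.cocycle.pullback (slice X 1)).Iso (b.cocycle.pullback (slice X 0)) :=
    Quotient.exact (hW.trans hW'.symm)
  obtain ⟨p1, p2⟩ := (Cocycle.iso_iff φ).1 hφ
  let r1 : C(X × unitInterval, X × unitInterval) :=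
    ⟨fun p => (p.1, Set.projIcc 0 1 zero_le_one (3 * (p.2 : ℝ))), by fun_prop⟩
  let r2 : C(X × unitInterval, X × unitInterval) :=
    ⟨fun p => (p.1, Set.projIcc 0 1 zero_le_one (3 * (p.2 : ℝ) - 2)), by fun_prop⟩
  let A : Set (X × unitInterval) := {p | (p.2 : ℝ) < 2 / 3}
  let B : Set (X × unitInterval) := {p | 1 / 3 < (p.2 : ℝ)}
  have hA : IsOpen A := isOpen_lt (by fun_prop) (by fun_prop)
  have hB : IsOpen B := isOpen_lt (by fun_prop) (by fun_prop)
  have hAB : ∀ p, p ∈ A ∨ p ∈ B := by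
    intro p
    by_cases h : (p.2 : ℝ) < 2 / 3
    · exact Or.inl h
    · refine Or.inr ?_
      change 1 / 3 < (p.2 : ℝ)
      linarith
  have e1 : ∀ p ∈ B, r1 p = slice X 1 p.1 := by
    intro p hp
    have hp : 1 / 3 < (p.2 : ℝ) := hp
    refine Prod.ext rfl ?_
    exact Set.projIcc_of_right_le zero_le_one (by linarith)
  have e2 : ∀ p ∈ A, r2 p = slice X 0 p.1 := by
    intro p hp
    have hp : (p.2 : ℝ) < 2 / 3 := hp
    refine Prod.ext rfl ?_
    exact Set.projIcc_of_le_left zero_le_one (by linarith)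
  have m1 : ∀ {α : a.ι} {p : X × unitInterval}, p ∈ (a.cocycle.pullback r1).U α → p ∈ B →
      p.1 ∈ (a.cocycle.pullback (slice X 1)).U α := by
    intro α p h hp
    have h : r1 p ∈ a.cocycle.U α := h
    rw [e1 p hp] at h
    exact h
  have m2 : ∀ {γ : b.ι} {p : X × unitInterval}, p ∈ (b.cocycle.pullback r2).U γ → p ∈ A →
      p.1 ∈ (b.cocycle.pullback (slice X 0)).U γ := by
    intro γ p h hp
    have h : r2 p ∈ b.cocycle.U γ := h
    rw [e2 p hp] at h
    exact h
  let Φ : (γ : b.ι) → (α : a.ι) → C(↥(((a.cocycle.pullback r1).U α ∩ A) ∩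
      ((b.cocycle.pullback r2).U γ ∩ B)), M) := fun γ α =>
    ⟨fun p => φ γ α ⟨p.1.1, m1 p.2.1.1 p.2.2.2, m2 p.2.2.1 p.2.1.2⟩, by fun_prop⟩
  have c1 : ∀ α γ δ p (hα : p ∈ (a.cocycle.pullback r1).U α ∩ A)
      (hγ : p ∈ (b.cocycle.pullback r2).U γ ∩ B) (hδ : p ∈ (b.cocycle.pullback r2).U δ ∩ B),
      G.Composes ((b.cocycle.pullback r2).f δ γ ⟨p, hγ.1, hδ.1⟩) (Φ γ α ⟨p, hα, hγ⟩)
        (Φ δ α ⟨p, hα, hδ⟩) := by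
    intro α γ δ p hα hγ hδ
    have := p1 α γ δ p.1 (m1 hα.1 hγ.2) (m2 hγ.1 hα.2) (m2 hδ.1 hα.2)
    have e : (b.cocycle.pullback r2).f δ γ ⟨p, hγ.1, hδ.1⟩ =
        (b.cocycle.pullback (slice X 0)).f δ γ ⟨p.1, m2 hγ.1 hα.2, m2 hδ.1 hα.2⟩ :=
      congrArg (b.cocycle.f δ γ) (Subtype.ext (e2 p hα.2))
    rw [e]
    exact this
  have c2 : ∀ α β δ p (hα : p ∈ (a.cocycle.pullback r1).U α ∩ A)
      (hβ : p ∈ (a.cocycle.pullback r1).U β ∩ A) (hδ : p ∈ (b.cocycle.pullback r2).U δ ∩ B),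
      G.Composes (Φ δ β ⟨p, hβ, hδ⟩) ((a.cocycle.pullback r1).f β α ⟨p, hα.1, hβ.1⟩)
        (Φ δ α ⟨p, hα, hδ⟩) := by
    intro α β δ p hα hβ hδ
    have := p2 α β δ p.1 (m1 hα.1 hδ.2) (m1 hβ.1 hδ.2) (m2 hδ.1 hα.2)
    have e : (a.cocycle.pullback r1).f β α ⟨p, hα.1, hβ.1⟩ =
        (a.cocycle.pullback (slice X 1)).f β α ⟨p.1, m1 hα.1 hδ.2, m1 hβ.1 hδ.2⟩ :=
      congrArg (a.cocycle.f β α) (Subtype.ext (e1 p hδ.2))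
    rw [e]
    exact this
  let χ : C(X × unitInterval, ℝ) :=
    ⟨fun p => max 0 (min 1 (3 - 5 * (p.2 : ℝ))), by fun_prop⟩
  have n := Cocycle.isNumerable_glue (a.cocycle.pullback r1) (b.cocycle.pullback r2)
    (a.isNumerable.pullback r1) (b.isNumerable.pullback r2) A B hA hB hAB Φ c1 c2 χ
    (fun p => le_max_left _ _) (fun p => max_le zero_le_one (min_le_left _ _))
    (by
      refine (closure_minimal (t := {p : X × unitInterval | (p.2 : ℝ) ≤ 3 / 5}) ?_
        (isClosed_le (by fun_prop) (by fun_prop))).trans ?_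
      · intro p hp
        by_contra h
        have h : ¬ (p.2 : ℝ) ≤ 3 / 5 := h
        refine hp (max_eq_left ((min_le_right _ _).trans ?_))
        linarith
      · intro p hp
        have hp : (p.2 : ℝ) ≤ 3 / 5 := hp
        change (p.2 : ℝ) < 2 / 3
        linarith)
    (by
      refine (closure_minimal (t := {p : X × unitInterval | 2 / 5 ≤ (p.2 : ℝ)}) ?_
        (isClosed_le (by fun_prop) (by fun_prop))).trans ?_
      · intro p hp
        by_contra h
        have h : ¬ 2 / 5 ≤ (p.2 : ℝ) := h
        refine hp ?_
        change 1 - max 0 (min 1 (3 - 5 * (p.2 : ℝ))) = 0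
        rw [min_eq_left (by linarith), max_eq_right zero_le_one, sub_self]
      · intro p hp
        have hp : 2 / 5 ≤ (p.2 : ℝ) := hp
        change 1 / 3 < (p.2 : ℝ)
        linarith)
  have s1 : r1.comp (slice X 0) = slice X 0 := ContinuousMap.ext fun x =>
    Prod.ext rfl (Set.projIcc_of_le_left zero_le_one (by simp [slice]))
  have s2 : r2.comp (slice X 1) = slice X 1 := ContinuousMap.ext fun x =>
    Prod.ext rfl (Set.projIcc_of_right_le zero_le_one (by norm_num [slice]))
  have a0 : ∀ x : X, slice X 0 x ∈ A := fun x => by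
    change ((0 : unitInterval) : ℝ) < 2 / 3
    norm_num
  have b1 : ∀ x : X, slice X 1 x ∈ B := fun x => by
    change 1 / 3 < ((1 : unitInterval) : ℝ)
    norm_num
  refine ⟨Quotient.mk _ ⟨a.ι ⊕ b.ι, _, n⟩, ?_, ?_⟩
  · have h : pullback (Quotient.mk _ ⟨a.ι ⊕ b.ι, _, n⟩ : NumerableStructure G _) (slice X 0) =
        pullback (pullback (Quotient.mk _ a : NumerableStructure G _) r1) (slice X 0) :=
      Quotient.sound (Cocycle.Iso.symm
        (Cocycle.glue_pullback_left _ _ A B hA hB hAB Φ c1 c2 (slice X 0) a0))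
    exact h.trans ((pullback_pullback _ _ _).trans (congrArg (pullback _) s1))
  · have h : pullback (Quotient.mk _ ⟨a.ι ⊕ b.ι, _, n⟩ : NumerableStructure G _) (slice X 1) =
        pullback (pullback (Quotient.mk _ b : NumerableStructure G _) r2) (slice X 1) :=
      Quotient.sound (Cocycle.Iso.symm
        (Cocycle.glue_pullback_right _ _ A B hA hB hAB Φ c1 c2 (slice X 1) b1))
    exact h.trans ((pullback_pullback _ _ _).trans (congrArg (pullback _) s2))

instance homotopicSetoid (G : TopGroupoid O M) (X : Type*) [TopologicalSpace X] :
    Setoid (NumerableStructure.{w} G X) where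
  r := Homotopic
  iseqv := ⟨Homotopic.refl, Homotopic.symm, Homotopic.trans⟩

end NumerableStructure

/-- The set `G_nu(X)` of homotopy classes of numerable `G`-structures on `X`. -/
def NumerableHomotopyClass (G : TopGroupoid O M) (X : Type*) [TopologicalSpace X] : Type _ :=
  Quotient (NumerableStructure.homotopicSetoid.{w} G X)

/-- The element of `G_nu(X)` represented by a numerable cocycle. -/
def NumerableHomotopyClass.mk {G : TopGroupoid O M} {X : Type*} [TopologicalSpace X]
    {ι : Type w} (u : Cocycle G X ι) (hu : u.IsNumerable) : NumerableHomotopyClass.{w} G X :=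
  Quotient.mk _ (Quotient.mk _ ⟨ι, u, hu⟩ : NumerableStructure G X)

/-- The set `[X, Y]` of homotopy classes of continuous maps. -/
def MapHomotopyClass (X Y : Type*) [TopologicalSpace X] [TopologicalSpace Y] : Type _ :=
  Quotient (⟨ContinuousMap.Homotopic, ContinuousMap.Homotopic.equivalence⟩ : Setoid C(X, Y))

/-- The homotopy class of a continuous map. -/
def MapHomotopyClass.mk {X Y : Type*} [TopologicalSpace X] [TopologicalSpace Y] (h : C(X, Y)) :
    MapHomotopyClass X Y :=
  Quotient.mk _ h

/-! ### The universal cocycle and classifying maps -/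

/-- `γ` is the universal cocycle on `B G`: its cover consists of the sets `t_n⁻¹(0, 1]` for
`n ∈ ℕ`, and at the class of `(F, t)` in `Ner_k G × Δ^k`, over `i₀ < ⋯ < i_k`, its transition
morphism from the index `i_j` to the index `i_l` is the composite `F_j → ⋯ → F_l` if `j ≤ l`
(an identity if `j = l`), and the inverse of `F_l → ⋯ → F_j` if `l < j`. -/
structure IsUniversalCocycle {G : TopGroupoid O M}
    (γ : Cocycle G (StasheffSpace G.toTopCategory) (ULift.{w} ℕ)) : Prop where
  U_eq : ∀ n, γ.U n = {p | 0 < StasheffSpace.coord n.down p}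
  f_eq_of_le : ∀ (k : ℕ) (α : Fin (k + 1) ↪o ℕ) (F : Nerve G.toTopCategory k)
    (t : stdSimplex ℝ (Fin (k + 1))) (j l : Fin (k + 1)) (h : j ≤ l)
    (hj : StasheffSpace.mk α F t ∈ γ.U ⟨α j⟩) (hl : StasheffSpace.mk α F t ∈ γ.U ⟨α l⟩),
    γ.f ⟨α l⟩ ⟨α j⟩ ⟨StasheffSpace.mk α F t, hj, hl⟩ = F.hom j l h
  f_eq_of_lt : ∀ (k : ℕ) (α : Fin (k + 1) ↪o ℕ) (F : Nerve G.toTopCategory k)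
    (t : stdSimplex ℝ (Fin (k + 1))) (j l : Fin (k + 1)) (h : l < j)
    (hj : StasheffSpace.mk α F t ∈ γ.U ⟨α j⟩) (hl : StasheffSpace.mk α F t ∈ γ.U ⟨α l⟩),
    γ.f ⟨α l⟩ ⟨α j⟩ ⟨StasheffSpace.mk α F t, hj, hl⟩ = G.inv (F.hom l j h.le)

/-- For a point `x` of `U (i 0) ∩ ⋯ ∩ U (i k)`, the simplex of the nerve with the morphisms
`u.f (i l) (i j) x` from the `j`-th to the `l`-th vertex. -/
def Cocycle.simplexAt {G : TopGroupoid O M} {X : Type*} [TopologicalSpace X] {ι : Type*}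
    (u : Cocycle G X ι) {k : ℕ} (i : Fin (k + 1) → ι) (x : X) (hx : ∀ j, x ∈ u.U (i j)) :
    Nerve G.toTopCategory k :=
  ⟨fun p => u.f (i p.1.2) (i p.1.1) ⟨x, hx p.1.1, hx p.1.2⟩,
    fun j => ⟨_, TopGroupoid.eq_one_of_composes (u.idem (i j) x (hx j))⟩,
    fun j l m _ _ => u.comp_f (i j) (i l) (i m) x (hx j) (hx l) (hx m)⟩

/-- `c : X → B G` is the classifying map of a countable cocycle `u`, with index set enumerated by
`e : ι ↪ ℕ`, and a partition of unity `ρ`: if `e (i 0) < ⋯ < e (i k)`, the point `x` lies in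
`U (i 0) ∩ ⋯ ∩ U (i k)` and the numbers `ρ (i j) x` have sum `1`, then `c x` is the class of
`(u.f (i 1) (i 0) x, …, u.f (i k) (i (k - 1)) x; ρ (i 0) x, …, ρ (i k) x)` in
`Ner_k G × Δ^k` over `e (i 0) < ⋯ < e (i k)`. -/
def IsClassifyingMap {G : TopGroupoid O M} {X : Type*} [TopologicalSpace X] {ι : Type*}
    (u : Cocycle G X ι) (ρ : PartitionOfUnity ι X Set.univ) (e : ι ↪ ℕ)
    (c : C(X, StasheffSpace G.toTopCategory)) : Prop :=
  ∀ (x : X) (k : ℕ) (α : Fin (k + 1) ↪o ℕ) (i : Fin (k + 1) → ι) (_ : ∀ j, e (i j) = α j)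
    (hx : ∀ j, x ∈ u.U (i j)) (t : stdSimplex ℝ (Fin (k + 1))) (_ : ∀ j, t j = ρ (i j) x),
    c x = StasheffSpace.mk α (u.simplexAt i x hx) t

end Cocycles

end StasheffClassification

end

open StasheffClassification

/-!
A point of `B G` is determined by its barycentric coordinates `t_n` and by the morphisms between
those of its vertices at which `t_n` does not vanish (`StasheffSpace.ext_transition`). All points
and maps below are therefore described by coordinates and transition morphisms, and relations
between them are checked on these.

The transition morphisms are continuous since, on every simplex, they are morphisms of the simplex
or inverses of such; they form the universal cocycle. In the quotient topology the `t_n` are not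
locally finite, but `max 0 (t_n - (∑ t_m ^ 2) / 2)` are, and they give a subordinate partition of
unity (`isNumerable_universalCocycle`).

The basic construction of maps into `B G` starts from a cocycle on `Y`, a subordinate partition of
unity and a colouring of the indices by natural numbers, such that no two indices which are active
at the same point have the same colour. The colours serve as vertices, and the result is a
continuous map along which the universal cocycle pulls back to the given one
(`exists_classifyingMap`, `iso_pullback_universalCocycle`). It has three uses.

* For a countable cocycle, with distinct colours, it is the classifying map.
* For an arbitrary numerable cocycle, the indices are replaced by finite sets `S` of indices, active
  where the members of `S` dominate all others, and coloured by `#S`. This gives surjectivity of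
  `[c] ↦ [c^* γ]` (`Cocycle.IsNumerable.exists_iso_pullback`).
* On `Y × [0, 1]`, two isomorphic cocycles glue to one, and a partition of unity which moves the
  weights from the members of the first to those of the second gives a homotopy between the
  classifying maps (`homotopic_of_weights`).

For injectivity it suffices, by surjectivity over `X × [0, 1]`, that maps `c₀`, `c₁` for which
`c₀^* γ` and `c₁^* γ` are isomorphic are homotopic (`homotopic_of_iso_pullback`). The identity of
`B G` is homotopic to a map with locally finite coordinates, by a homotopy linear on every simplex
(`exists_homotopic_id`), so that `c₀` and `c₁` may be replaced by classifying maps of countable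
cocycles. The vertices of the first are moved to odd numbers and those of the second to even
numbers, one vertex after the other from infinity downwards (`homotopic_double`); then the weights
can be moved linearly.

The homeomorphism with the realization of the nerve of `G^ℕ` forgets the numbering of a simplex,
which is recorded in its vertices. In the inverse direction, the numbers `i₀ ≤ ⋯ ≤ i_k` of the
vertices are locally constant on the nerve, and a simplex with repeated numbers is degenerate, since
between vertices with the same number there are only identities (`stasheffHomeomorph`).
-/

noncomputable section

namespace StasheffClassification

open Set Topology

/-! ### Points of the classifying space -/

section Points

variable {O M : Type*} [TopologicalSpace O] [TopologicalSpace M]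

namespace Nerve

variable {G : TopGroupoid O M} {k m : ℕ}

/-- The morphism from the `i`-th to the `j`-th vertex of a simplex of the nerve of a groupoid,
for `i` and `j` in any order. -/
def trans (F : Nerve G.toTopCategory k) (i j : Fin (k + 1)) : M :=
  if h : i ≤ j then F.hom i j h else G.inv (F.hom j i (le_of_not_ge h))

theorem trans_of_le (F : Nerve G.toTopCategory k) {i j : Fin (k + 1)} (h : i ≤ j) :
    F.trans i j = F.hom i j h := dif_pos h

theorem trans_of_lt (F : Nerve G.toTopCategory k) {i j : Fin (k + 1)} (h : j < i) :
    F.trans i j = G.inv (F.hom j i h.le) := dif_neg (not_le.2 h)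

theorem composes_trans (F : Nerve G.toTopCategory k) (i j l : Fin (k + 1)) :
    G.Composes (F.trans j l) (F.trans i j) (F.trans i l) := by
  have H : ∀ a b c (h : a ≤ b) (h' : b ≤ c),
    G.Composes (F.hom b c h') (F.hom a b h) (F.hom a c (h.trans h')) := F.2.2
  rcases le_or_gt i j with h1 | h1 <;> rcases le_or_gt j l with h2 | h2 <;>
    rcases le_or_gt i l with h3 | h3 <;>
    simp only [trans_of_le, trans_of_lt, h1, h2, h3]
  · exact H _ _ _ h1 h2
  · exact absurd (h1.trans h2) (not_le.2 h3)
  · exact TopGroupoid.inv_left (H _ _ _ h3 h2.le)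
  · exact TopGroupoid.inv_left (TopGroupoid.inv_right (H _ _ _ h3.le h1))
  · exact TopGroupoid.inv_right (H _ _ _ h1.le h3)
  · exact TopGroupoid.inv_right (TopGroupoid.inv_left (H _ _ _ h2 h3.le))
  · exact absurd (h2.trans h1) (not_lt.2 h3)
  · exact TopGroupoid.inv_left (TopGroupoid.inv_right (TopGroupoid.inv_left (H _ _ _ h2.le h1.le)))

theorem continuous_trans (i j : Fin (k + 1)) :
    Continuous fun F : Nerve G.toTopCategory k => F.trans i j := by
  have H : ∀ (a b : Fin (k + 1)) (h : a ≤ b),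
      Continuous fun F : Nerve G.toTopCategory k => F.hom a b h := fun a b h =>
    (continuous_apply _).comp continuous_subtype_val
  by_cases h : i ≤ j
  · simpa only [trans_of_le _ h] using H i j h
  · simp only [trans_of_lt _ (not_le.1 h)]
    exact G.continuous_inv.comp (H j i _)

theorem ext_trans {F F' : Nerve G.toTopCategory k} (h : ∀ i j, F.trans i j = F'.trans i j) :
    F = F' := by
  refine Subtype.ext (funext fun p => ?_)
  have := h p.1.1 p.1.2
  rwa [trans_of_le _ p.2, trans_of_le _ p.2] at this

theorem trans_symm (F : Nerve G.toTopCategory k) (i j : Fin (k + 1)) :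
    F.trans i j = G.inv (F.trans j i) := by
  have h := TopGroupoid.inv_left (F.composes_trans i j i)
  exact h.unique (TopGroupoid.composes_of_idem_right (F.composes_trans i i i) h.1)

theorem restrict_trans (F : Nerve G.toTopCategory k) (θ : Fin (m + 1) →o Fin (k + 1))
    (i j : Fin (m + 1)) : (F.restrict θ).trans i j = F.trans (θ i) (θ j) := by
  rcases le_or_gt i j with h | h
  · rw [trans_of_le _ h, trans_of_le _ (θ.monotone h)]; rfl
  · rw [trans_of_lt _ h, trans_symm F, trans_of_le _ (θ.monotone h.le)]; rfl

end Nerve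

namespace StasheffSpace

section Coord

variable {C : TopCategory O M} {k : ℕ}

/-- The quotient map onto `B C`. -/
def proj (p : PreStasheff C) : StasheffSpace C := Quot.mk _ p

theorem isQuotientMap_proj : IsQuotientMap (proj : PreStasheff C → StasheffSpace C) :=
  isQuotientMap_quot_mk

theorem proj_surjective : Function.Surjective (proj : PreStasheff C → StasheffSpace C) :=
  Quot.mk_surjective

theorem proj_out (p : StasheffSpace C) : proj (Quot.out p) = p := Quot.out_eq p

theorem coord_mk (n : ℕ) (α : Fin (k + 1) ↪o ℕ) (F : Nerve C k)
    (t : stdSimplex ℝ (Fin (k + 1))) :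
    coord n (mk α F t) = ∑ i, if α i = n then t i else 0 := rfl

theorem coord_mk_apply (α : Fin (k + 1) ↪o ℕ) (F : Nerve C k)
    (t : stdSimplex ℝ (Fin (k + 1))) (j : Fin (k + 1)) : coord (α j) (mk α F t) = t j := by
  rw [coord_mk, Finset.sum_eq_single j]
  · simp
  · intro b _ hb
    exact if_neg fun h => hb (α.injective h)
  · simp

theorem coord_mk_of_notMem {n : ℕ} (α : Fin (k + 1) ↪o ℕ) (F : Nerve C k)
    (t : stdSimplex ℝ (Fin (k + 1))) (h : ∀ j, α j ≠ n) : coord n (mk α F t) = 0 := by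
  rw [coord_mk]
  exact Finset.sum_eq_zero fun i _ => if_neg (h i)

theorem exists_of_coord_ne_zero {n : ℕ} {α : Fin (k + 1) ↪o ℕ} {F : Nerve C k}
    {t : stdSimplex ℝ (Fin (k + 1))} (h : coord n (mk α F t) ≠ 0) : ∃ j, α j = n := by
  by_contra h'
  push Not at h'
  exact h (coord_mk_of_notMem α F t h')

theorem exists_mk (p : StasheffSpace C) : ∃ (k : ℕ) (α : Fin (k + 1) ↪o ℕ) (F : Nerve C k)
    (t : stdSimplex ℝ (Fin (k + 1))), p = mk α F t := by
  obtain ⟨⟨⟨k, α⟩, F, t⟩, rfl⟩ := Quot.exists_rep p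
  exact ⟨k, α, F, t, rfl⟩

theorem coord_nonneg (n : ℕ) (p : StasheffSpace C) : 0 ≤ coord n p := by
  obtain ⟨k, α, F, t, rfl⟩ := exists_mk p
  rw [coord_mk]
  refine Finset.sum_nonneg fun i _ => ?_
  split_ifs
  · exact t.2.1 i
  · exact le_rfl

theorem continuous_mk (α : Fin (k + 1) ↪o ℕ) :
    Continuous fun q : Nerve C k × stdSimplex ℝ (Fin (k + 1)) => mk α q.1 q.2 :=
  continuous_quot_mk.comp (continuous_sigmaMk (σ := fun a : (Σ k : ℕ, Fin (k + 1) ↪o ℕ) =>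
    Nerve C a.1 × stdSimplex ℝ (Fin (a.1 + 1))) (i := ⟨k, α⟩))

/-- A map out of `B C` is continuous if it is so on every simplex. -/
theorem continuous_of_mk {Z : Type*} [TopologicalSpace Z] {g : StasheffSpace C → Z}
    (h : ∀ (k : ℕ) (α : Fin (k + 1) ↪o ℕ),
      Continuous fun q : Nerve C k × stdSimplex ℝ (Fin (k + 1)) => g (mk α q.1 q.2)) :
    Continuous g :=
  isQuotientMap_proj.continuous_iff.2 (continuous_sigma fun a => h a.1 a.2)

theorem continuous_simplex_apply (i : Fin (k + 1)) :
    Continuous fun t : stdSimplex ℝ (Fin (k + 1)) => t i :=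
  (continuous_apply i).comp continuous_subtype_val

theorem continuous_coord (n : ℕ) : Continuous (coord n : StasheffSpace C → ℝ) := by
  refine continuous_of_mk fun k α => ?_
  simp only [coord_mk]
  refine continuous_finsetSum _ fun i _ => ?_
  split_ifs
  · exact (continuous_simplex_apply i).comp continuous_snd
  · exact continuous_const

/-- Every point of `B C` is represented by a point in the interior of a simplex. -/
theorem exists_mk_pos (p : StasheffSpace C) : ∃ (k : ℕ) (α : Fin (k + 1) ↪o ℕ) (F : Nerve C k)
    (t : stdSimplex ℝ (Fin (k + 1))), p = mk α F t ∧ ∀ j, 0 < t j := by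
  obtain ⟨k, α, F, t, rfl⟩ := exists_mk p
  induction k with
  | zero =>
    refine ⟨0, α, F, t, rfl, fun j => ?_⟩
    have := t.2.2
    rw [Fin.sum_univ_one] at this
    obtain rfl : j = 0 := Fin.eq_zero j
    change 0 < t.1 0
    linarith
  | succ k ih =>
    by_cases h : ∀ j, 0 < t j
    · exact ⟨k + 1, α, F, t, rfl, h⟩
    push Not at h
    obtain ⟨j, hj⟩ := h
    have hj : t.1 j = 0 := le_antisymm hj (t.2.1 j)
    let t' : stdSimplex ℝ (Fin (k + 1)) := ⟨fun i => t.1 (j.succAbove i), fun i => t.2.1 _, by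
      have := t.2.2
      rwa [Fin.sum_univ_succAbove _ j, hj, zero_add] at this⟩
    have ht : t = stdSimplex.map j.succAbove t' := by
      refine Subtype.ext (funext fun i => ?_)
      induction i using Fin.succAboveCases j with
      | x => exact hj.trans (map_succAbove_self j t').symm
      | p i => exact (map_succAbove_succAbove j t' i).symm
    have e : mk α F t = mk ((Fin.succAboveOrderEmb j).trans α)
        (F.restrict (Fin.succAboveOrderEmb j).toOrderHom) t' := by
      rw [ht]
      exact Quot.sound (StasheffRel.face k α F j t')
    rw [e]
    exact ih _ _ _

end Coord

variable {G : TopGroupoid O M} {k : ℕ}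

/-- The position of `n` in the sequence `α`, and `0` if `n` does not occur. -/
def position (α : Fin (k + 1) ↪o ℕ) (n : ℕ) : Fin (k + 1) :=
  if h : ∃ j, α j = n then h.choose else 0

theorem position_apply (α : Fin (k + 1) ↪o ℕ) (j : Fin (k + 1)) : position α (α j) = j := by
  have h : ∃ i, α i = α j := ⟨j, rfl⟩
  rw [position, dif_pos h]
  exact α.injective h.choose_spec

/-- The morphism from the vertex `m` to the vertex `n` of a point of `PreStasheff`. It is only
meaningful if both are vertices of the simplex. -/
def preTransition (m n : ℕ) (p : PreStasheff G.toTopCategory) : M :=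
  p.2.1.trans (position p.1.2 m) (position p.1.2 n)

theorem continuous_preTransition (m n : ℕ) :
    Continuous (preTransition m n : PreStasheff G.toTopCategory → M) :=
  continuous_sigma fun a => (Nerve.continuous_trans (position a.2 m) (position a.2 n)).comp
    (continuous_fst (Y := stdSimplex ℝ (Fin (a.1 + 1))))

/-- The face relation only omits vertices with vanishing coordinate, and it does not change the
morphisms between the others. -/
theorem preTransition_eq_of_rel {m n : ℕ} {p q : PreStasheff G.toTopCategory}
    (h : StasheffRel G.toTopCategory p q)
    (hm : coord m (proj q) ≠ 0)
    (hn : coord n (proj q) ≠ 0) :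
    preTransition m n p = preTransition m n q := by
  obtain ⟨k, α, F, j, t⟩ := h
  obtain ⟨i, rfl⟩ := exists_of_coord_ne_zero
    (α := (Fin.succAboveOrderEmb j).trans α) (t := t) hm
  obtain ⟨l, rfl⟩ := exists_of_coord_ne_zero
    (α := (Fin.succAboveOrderEmb j).trans α) (t := t) hn
  have e : ∀ i, position α (((Fin.succAboveOrderEmb j).trans α) i) = Fin.succAboveOrderEmb j i :=
    fun i => position_apply α _
  simp only [preTransition, e, position_apply]
  exact (Nerve.restrict_trans F (Fin.succAboveOrderEmb j).toOrderHom i l).symm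

open Classical in
theorem preTransition_eq_of_mk_eq {m n : ℕ} {p q : PreStasheff G.toTopCategory}
    (h : proj p = proj q)
    (hm : coord m (proj p) ≠ 0)
    (hn : coord n (proj p) ≠ 0) :
    preTransition m n p = preTransition m n q := by
  -- the transition morphism as a partial function, which descends to the quotient
  let T : StasheffSpace G.toTopCategory → Option M := Quot.lift
    (fun p => if coord m (proj p) ≠ 0 ∧
      coord n (proj p) ≠ 0 then
        some (preTransition m n p) else none) (by
    intro p q h
    have e : proj p = proj q := Quot.sound h
    rw [e]
    split_ifs with h'
    · rw [preTransition_eq_of_rel h h'.1 h'.2]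
    · rfl)
  have hT : T (proj p) = T (proj q) := congrArg T h
  change (if _ then _ else _) = (if _ then _ else _) at hT
  rw [← h, if_pos ⟨hm, hn⟩, if_pos ⟨hm, hn⟩] at hT
  exact Option.some_injective _ hT

/-- The morphism from the vertex `m` to the vertex `n` at a point of `B G`, computed on an arbitrary
representative. It is only meaningful where the barycentric coordinates at `m` and at `n` do not
vanish. -/
def transition (m n : ℕ) (p : StasheffSpace G.toTopCategory) : M :=
  preTransition m n (Quot.out p)

theorem transition_mk {m n : ℕ} (p : PreStasheff G.toTopCategory)
    (hm : coord m (proj p) ≠ 0)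
    (hn : coord n (proj p) ≠ 0) :
    transition m n (proj p) = preTransition m n p :=
  (preTransition_eq_of_mk_eq (proj_out _).symm hm hn).symm

theorem transition_mk_apply (α : Fin (k + 1) ↪o ℕ) (F : Nerve G.toTopCategory k)
    (t : stdSimplex ℝ (Fin (k + 1))) {j l : Fin (k + 1)} (hj : t j ≠ 0) (hl : t l ≠ 0) :
    transition (α j) (α l) (mk α F t) = F.trans j l := by
  change transition _ _ (proj _) = _
  rw [transition_mk]
  · simp only [preTransition, position_apply]
  · exact (coord_mk_apply α F t _).trans_ne ‹_›
  · exact (coord_mk_apply α F t _).trans_ne ‹_›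

theorem composes_transition {l m n : ℕ} (p : StasheffSpace G.toTopCategory) (hl : coord l p ≠ 0)
    (hm : coord m p ≠ 0) (hn : coord n p ≠ 0) :
    G.Composes (transition m n p) (transition l m p) (transition l n p) := by
  obtain ⟨p, rfl⟩ := proj_surjective p
  rw [transition_mk p hl hm, transition_mk p hl hn, transition_mk p hm hn]
  exact Nerve.composes_trans _ _ _ _

theorem continuousOn_transition (m n : ℕ) :
    ContinuousOn (transition m n : StasheffSpace G.toTopCategory → M)
      {p | coord m p ≠ 0 ∧ coord n p ≠ 0} := by
  have ho : IsOpen {p : StasheffSpace G.toTopCategory | coord m p ≠ 0 ∧ coord n p ≠ 0} :=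
    ((continuous_coord m).isOpen_preimage _ isOpen_ne).inter
      ((continuous_coord n).isOpen_preimage _ isOpen_ne)
  rw [continuousOn_iff_continuous_domRestrict]
  -- the restriction of a quotient map over an open set is again a quotient map
  have hq := (isQuotientMap_proj (C := G.toTopCategory)).restrictPreimage_isOpen ho
  refine hq.continuous_iff.2 ?_
  have e : domRestrict {p : StasheffSpace G.toTopCategory | coord m p ≠ 0 ∧ coord n p ≠ 0}
      (transition m n) ∘ restrictPreimage _ (proj) =
      fun p => preTransition m n p.1 :=
    funext fun p => transition_mk p.1 p.2.1 p.2.2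
  rw [e]
  exact (continuous_preTransition m n).comp continuous_subtype_val

/-- A point of `B G` is determined by its barycentric coordinates and by the morphisms between
those of its vertices whose coordinates do not vanish. -/
theorem ext_transition {p q : StasheffSpace G.toTopCategory} (h : ∀ n, coord n p = coord n q)
    (h' : ∀ m n, coord m p ≠ 0 → coord n p ≠ 0 → transition m n p = transition m n q) :
    p = q := by
  obtain ⟨k, α, F, t, rfl, ht⟩ := exists_mk_pos p
  obtain ⟨l, β, F', t', rfl, ht'⟩ := exists_mk_pos q
  -- in the interior of a simplex, the vertices are those with nonvanishing coordinate
  have hr : ∀ {k : ℕ} (α : Fin (k + 1) ↪o ℕ) (F : Nerve G.toTopCategory k)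
      (t : stdSimplex ℝ (Fin (k + 1))), (∀ j, 0 < t j) →
      range α = {n | coord n (mk α F t) ≠ 0} := by
    intro k α F t ht
    ext n
    constructor
    · rintro ⟨j, rfl⟩
      rw [mem_ofPred, coord_mk_apply]
      exact (ht j).ne'
    · exact fun h => exists_of_coord_ne_zero h
  have e : range α = range β := by
    rw [hr α F t ht, hr β F' t' ht']
    simp only [h]
  obtain rfl : k = l := by
    have h1 := Nat.card_range_of_injective α.injective
    have h2 := Nat.card_range_of_injective β.injective
    rw [e, h2] at h1
    simpa using h1.symm
  obtain rfl : α = β := DFunLike.coe_injective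
    ((StrictMono.range_inj α.strictMono β.strictMono).1 e)
  obtain rfl : t = t' := by
    refine Subtype.ext (funext fun j => ?_)
    have := h (α j)
    rwa [coord_mk_apply, coord_mk_apply] at this
  obtain rfl : F = F' := by
    refine Nerve.ext_trans fun i j => ?_
    have := h' (α i) (α j) (by rw [coord_mk_apply]; exact (ht i).ne')
      (by rw [coord_mk_apply]; exact (ht j).ne')
    rwa [transition_mk_apply _ _ _ (ht i).ne' (ht j).ne',
      transition_mk_apply _ _ _ (ht i).ne' (ht j).ne'] at this
  rfl

end StasheffSpace

end Points

/-! ### The universal cocycle -/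

/-- A locally finite family of nonnegative functions without common zeros can be normalized to a
partition of unity with the same supports. -/
theorem exists_partitionOfUnity_support_eq {ι X : Type*} [TopologicalSpace X] (w : ι → C(X, ℝ))
    (hw : LocallyFinite fun i => Function.support (w i)) (h0 : ∀ i x, 0 ≤ w i x)
    (hpos : ∀ x, ∃ i, w i x ≠ 0) :
    ∃ ρ : PartitionOfUnity ι X univ, ∀ i, Function.support (ρ i) = Function.support (w i) := by
  have hc : Continuous fun x => ∑ᶠ i, w i x := continuous_finsum (fun i => (w i).continuous) hw
  have hfin : ∀ x, (Function.support fun i => w i x).Finite := hw.point_finite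
  have hs : ∀ x, 0 < ∑ᶠ i, w i x := by
    intro x
    obtain ⟨i, hi⟩ := hpos x
    exact finsum_pos (fun i => h0 i x) ⟨i, (h0 i x).lt_of_ne' hi⟩ (hfin x)
  have h1 : ∀ x, ∑ᶠ i, w i x / ∑ᶠ j, w j x = 1 := by
    intro x
    simp only [div_eq_mul_inv]
    rw [← finsum_mul, mul_inv_cancel₀ (hs x).ne']
  have hsupp : ∀ i, (Function.support fun x => w i x / ∑ᶠ j, w j x) =
      Function.support (w i) := by
    intro i
    ext x
    simp [(hs x).ne']
  refine ⟨⟨fun i => ⟨fun x => w i x / ∑ᶠ j, w j x, (w i).continuous.div hc fun x => (hs x).ne'⟩,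
    ?_, fun i x => div_nonneg (h0 i x) (hs x).le, fun x _ => h1 x, fun x => (h1 x).le⟩, hsupp⟩
  convert hw using 2 with i
  exact hsupp i

section Universal

variable {O M : Type*} [TopologicalSpace O] [TopologicalSpace M]

namespace StasheffSpace

variable {C : TopCategory O M} {k : ℕ}

theorem finsum_coord_mk (g : ℝ → ℝ) (hg : g 0 = 0) (α : Fin (k + 1) ↪o ℕ) (F : Nerve C k)
    (t : stdSimplex ℝ (Fin (k + 1))) : ∑ᶠ n, g (coord n (mk α F t)) = ∑ j, g (t j) := by
  rw [finsum_eq_sum_of_support_subset (s := Finset.univ.map α.toEmbedding)]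
  · rw [Finset.sum_map]
    exact Finset.sum_congr rfl fun j _ => congrArg g (coord_mk_apply α F t j)
  · intro n hn
    have : coord n (mk α F t) ≠ 0 := fun h => hn (by simp only [h, hg])
    obtain ⟨j, rfl⟩ := exists_of_coord_ne_zero this
    simp

theorem sum_coord_le_one (s : Finset ℕ) (p : StasheffSpace C) : ∑ n ∈ s, coord n p ≤ 1 := by
  obtain ⟨k, α, F, t, rfl⟩ := exists_mk p
  have h : (Function.support fun n => coord n (mk α F t)).Finite :=
    (finite_range α).subset fun n hn => exists_of_coord_ne_zero hn
  have e : ∑ᶠ n, coord n (mk α F t) = 1 :=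
    (finsum_coord_mk (fun x => x) rfl α F t).trans t.2.2
  rw [← e, finsum_eq_sum_of_support_subset (s := s ∪ h.toFinset) _ (by simp)]
  exact Finset.sum_le_sum_of_subset_of_nonneg Finset.subset_union_left
    fun n _ _ => coord_nonneg n _

theorem exists_sum_coord_eq_one (p : StasheffSpace C) : ∃ s : Finset ℕ, ∑ n ∈ s, coord n p = 1 := by
  obtain ⟨k, α, F, t, rfl⟩ := exists_mk p
  refine ⟨Finset.univ.map α.toEmbedding, ?_⟩
  rw [Finset.sum_map]
  exact (Finset.sum_congr rfl fun j _ => coord_mk_apply α F t j).trans t.2.2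

/-- The sum of the squares of the barycentric coordinates; it is used as a lower bound for the
largest coordinate. -/
def coordSq (p : StasheffSpace C) : ℝ := ∑ᶠ n, coord n p ^ 2

theorem coordSq_mk (α : Fin (k + 1) ↪o ℕ) (F : Nerve C k) (t : stdSimplex ℝ (Fin (k + 1))) :
    coordSq (mk α F t) = ∑ j, t j ^ 2 :=
  finsum_coord_mk (fun x => x ^ 2) (by norm_num) α F t

theorem continuous_coordSq : Continuous (coordSq : StasheffSpace C → ℝ) := by
  refine continuous_of_mk fun k α => ?_
  simp only [coordSq_mk]
  exact continuous_finsetSum _ fun i _ =>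
    ((continuous_simplex_apply i).comp continuous_snd).pow 2

theorem coordSq_pos (p : StasheffSpace C) : 0 < coordSq p := by
  obtain ⟨k, α, F, t, rfl, ht⟩ := exists_mk_pos p
  rw [coordSq_mk]
  exact Finset.sum_pos (fun j _ => pow_pos (ht j) 2) Finset.univ_nonempty

theorem exists_half_coordSq_lt (p : StasheffSpace C) : ∃ n, coordSq p / 2 < coord n p := by
  by_contra! h
  have hp := coordSq_pos p
  obtain ⟨k, α, F, t, rfl⟩ := exists_mk p
  have h1 : ∑ j, t j ^ 2 ≤ ∑ j, coordSq (mk α F t) / 2 * t j := by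
    refine Finset.sum_le_sum fun j _ => ?_
    rw [sq]
    exact mul_le_mul_of_nonneg_right ((coord_mk_apply α F t j).symm.le.trans (h (α j))) (t.2.1 j)
  rw [← Finset.mul_sum, ← coordSq_mk α F t] at h1
  have h2 : ∑ j, t j = 1 := t.2.2
  rw [h2] at h1
  linarith

end StasheffSpace

open StasheffSpace

/-- The universal cocycle on `B G`. -/
def universalCocycle (G : TopGroupoid O M) :
    Cocycle G (StasheffSpace G.toTopCategory) (ULift.{w} ℕ) where
  U n := {p | 0 < coord n.down p}
  isOpen_U n := isOpen_lt continuous_const (continuous_coord _)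
  cover p := by
    obtain ⟨n, hn⟩ := exists_half_coordSq_lt p
    exact ⟨⟨n⟩, (half_pos (coordSq_pos p)).trans hn⟩
  f n m := ⟨fun p => transition m.down n.down p.1,
    (continuousOn_transition m.down n.down).comp_continuous continuous_subtype_val
      fun p => ⟨p.2.1.ne', p.2.2.ne'⟩⟩
  comp_f _ _ _ p hl hm hn := composes_transition p hl.ne' hm.ne' hn.ne'

theorem isUniversalCocycle_universalCocycle (G : TopGroupoid O M) :
    IsUniversalCocycle (universalCocycle.{w} G) where
  U_eq _ := rfl
  f_eq_of_le k α F t j l h hj hl := by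
    have hj : 0 < coord (α j) (mk α F t) := hj
    have hl : 0 < coord (α l) (mk α F t) := hl
    rw [coord_mk_apply] at hj hl
    exact (transition_mk_apply α F t hj.ne' hl.ne').trans (F.trans_of_le h)
  f_eq_of_lt k α F t j l h hj hl := by
    have hj : 0 < coord (α j) (mk α F t) := hj
    have hl : 0 < coord (α l) (mk α F t) := hl
    rw [coord_mk_apply] at hj hl
    exact (transition_mk_apply α F t hj.ne' hl.ne').trans (F.trans_of_lt h)

/-- The barycentric coordinates themselves are only point-finite in the quotient topology. The
family `max 0 (t_n - (∑ t_m ^ 2) / 2)` is locally finite, since finitely many coordinates have sum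
close to `1` in a neighbourhood of a given point, and it has no common zero, since some coordinate
is at least `∑ t_m ^ 2`. -/
theorem isNumerable_universalCocycle (G : TopGroupoid O M) :
    (universalCocycle.{w} G).IsNumerable := by
  let W : ULift.{w} ℕ → C(StasheffSpace G.toTopCategory, ℝ) := fun n =>
    ⟨fun p => max 0 (coord n.down p - coordSq p / 2),
      continuous_const.max ((continuous_coord _).sub (continuous_coordSq.div_const 2))⟩
  have hW : ∀ n p, W n p ≠ 0 → coordSq p / 2 < coord n.down p := by
    intro n p h
    by_contra h'
    exact h (max_eq_left (by linarith))
  have hlf : LocallyFinite fun n => Function.support (W n) := by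
    intro p
    obtain ⟨s, hs⟩ := exists_sum_coord_eq_one p
    have hc : Continuous fun q : StasheffSpace G.toTopCategory => ∑ n ∈ s, coord n q :=
      continuous_finsetSum _ fun n _ => continuous_coord n
    refine ⟨{q | 1 < ∑ n ∈ s, coord n q + coordSq q / 2}, (isOpen_lt continuous_const
      (hc.add (continuous_coordSq.div_const 2))).mem_nhds ?_, ?_⟩
    · have := coordSq_pos p
      change 1 < ∑ n ∈ s, coord n p + coordSq p / 2
      linarith
    · refine (s.finite_toSet.image ULift.up).subset ?_
      rintro ⟨n⟩ ⟨q, hq, hq'⟩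
      by_contra h
      have hn : n ∉ s := fun h' => h ⟨n, h', rfl⟩
      have h1 := sum_coord_le_one (insert n s) q
      rw [Finset.sum_insert hn] at h1
      have h2 : coordSq q / 2 < coord n q := hW _ q hq
      have h3 : 1 < ∑ n ∈ s, coord n q + coordSq q / 2 := hq'
      linarith
  have hpos : ∀ p, ∃ n, W n p ≠ 0 := by
    intro p
    obtain ⟨n, hn⟩ := exists_half_coordSq_lt p
    refine ⟨⟨n⟩, ne_of_gt ?_⟩
    exact lt_max_of_lt_right (sub_pos.2 hn)
  obtain ⟨ρ, hρ⟩ := exists_partitionOfUnity_support_eq W hlf (fun n p => le_max_left _ _) hpos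
  refine ⟨ρ, fun n => ?_⟩
  rw [tsupport, hρ]
  refine (closure_minimal (t := {p | coordSq p / 2 ≤ coord n.down p})
    (fun p hp => (hW n p hp).le) (isClosed_le (continuous_coordSq.div_const 2)
      (continuous_coord _))).trans fun p hp => ?_
  exact (half_pos (coordSq_pos p)).trans_le hp

end Universal

/-! ### Classifying maps -/

section Classifying

variable {O M : Type*} [TopologicalSpace O] [TopologicalSpace M] {G : TopGroupoid O M}
  {Y : Type*} [TopologicalSpace Y] {ι κ : Type*}

open StasheffSpace

theorem PartitionOfUnity.sum_finset_le_one (ρ : PartitionOfUnity ι Y univ) (s : Finset ι) (y : Y) :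
    ∑ i ∈ s, ρ i y ≤ 1 := by
  classical
  have h := ρ.sum_eq_one (mem_univ y)
  rw [← h, finsum_eq_sum_of_support_subset (s := s ∪ (ρ.locallyFinite.point_finite y).toFinset) _
    (fun i hi => by simpa using Or.inr hi)]
  exact Finset.sum_le_sum_of_subset_of_nonneg Finset.subset_union_left fun i _ _ => ρ.nonneg i y

theorem PartitionOfUnity.sum_finset_eq_one (ρ : PartitionOfUnity ι Y univ) {s : Finset ι} {y : Y}
    (h : ∀ i ∉ s, ρ i y = 0) : ∑ i ∈ s, ρ i y = 1 := by
  rw [← ρ.sum_eq_one (mem_univ y), finsum_eq_sum_of_support_subset]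
  intro i hi
  by_contra h'
  exact hi (h i h')

theorem PartitionOfUnity.eq_zero_of_sum_eq_one (ρ : PartitionOfUnity ι Y univ) {s : Finset ι}
    {y : Y} (h : ∑ i ∈ s, ρ i y = 1) {i : ι} (hi : i ∉ s) : ρ i y = 0 := by
  classical
  have := PartitionOfUnity.sum_finset_le_one ρ (insert i s) y
  rw [Finset.sum_insert hi, h] at this
  exact le_antisymm (by linarith) (ρ.nonneg i y)

theorem PartitionOfUnity.IsSubordinate.mem {ρ : PartitionOfUnity ι Y univ} {U : ι → Set Y}
    (h : ρ.IsSubordinate U) {i : ι} {y : Y} (hi : ρ i y ≠ 0) : y ∈ U i :=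
  h i (subset_tsupport _ hi)

namespace Cocycle

theorem inv_f (u : Cocycle G Y ι) {i j : ι} {y : Y} (hi : y ∈ u.U i) (hj : y ∈ u.U j) :
    G.inv (u.f i j ⟨y, hj, hi⟩) = u.f j i ⟨y, hi, hj⟩ := by
  have h := TopGroupoid.inv_right (u.comp_f j i j y hj hi hj)
  exact (TopGroupoid.composes_of_idem_left (u.idem j y hj) h.1).unique h

theorem simplexAt_trans (u : Cocycle G Y ι) {k : ℕ} (i : Fin (k + 1) → ι) (y : Y)
    (hy : ∀ j, y ∈ u.U (i j)) (j l : Fin (k + 1)) :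
    (u.simplexAt i y hy).trans j l = u.f (i l) (i j) ⟨y, hy j, hy l⟩ := by
  rcases le_or_gt j l with h | h
  · exact Nerve.trans_of_le _ h
  · exact (Nerve.trans_of_lt _ h).trans (u.inv_f (hy j) (hy l))

/-- The cocycle `u` with the members of its cover listed by `g : κ → ι`, possibly with
repetitions. -/
def reindex (u : Cocycle G Y ι) (g : κ → ι) (hg : ∀ y, ∃ a, y ∈ u.U (g a)) : Cocycle G Y κ where
  U a := u.U (g a)
  isOpen_U a := u.isOpen_U (g a)
  cover := hg
  f b a := u.f (g b) (g a)
  comp_f a b c := u.comp_f (g a) (g b) (g c)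

theorem iso_reindex (u : Cocycle G Y ι) (g : κ → ι) (hg : ∀ y, ∃ a, y ∈ u.U (g a)) :
    u.Iso (u.reindex g hg) :=
  ⟨fun a i => u.f (g a) i, (iso_iff _).2
    ⟨fun i a b y hi ha hb => u.comp_f i (g a) (g b) y hi ha hb,
      fun i j a y hi hj ha => u.comp_f i j (g a) y hi hj ha⟩⟩

end Cocycle

/-- The indices of a partition of unity are given vertices `v i`, in such a way that no two indices
which are active at the same point share a vertex. -/
def IsColouring (ρ : PartitionOfUnity ι Y univ) (v : ι → ℕ) : Prop :=
  ∀ (y : Y) (i j : ι), ρ i y ≠ 0 → ρ j y ≠ 0 → v i = v j → i = j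

/-- The point `p` of `B G` has the barycentric coordinates `ρ i y` at the vertices `v i`, and the
transition morphisms of the cocycle `u` at `y` between them. -/
structure Represents (u : Cocycle G Y ι) (ρ : PartitionOfUnity ι Y univ) (v : ι → ℕ) (y : Y)
    (p : StasheffSpace G.toTopCategory) : Prop where
  coord_eq : ∀ i, ρ i y ≠ 0 → coord (v i) p = ρ i y
  exists_of_coord : ∀ n, coord n p ≠ 0 → ∃ i, ρ i y ≠ 0 ∧ v i = n
  transition_eq : ∀ (i j : ι) (hi : y ∈ u.U i) (hj : y ∈ u.U j), ρ i y ≠ 0 → ρ j y ≠ 0 →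
    transition (v i) (v j) p = u.f j i ⟨y, hi, hj⟩

variable {u : Cocycle G Y ι} {ρ : PartitionOfUnity ι Y univ} {v : ι → ℕ}

theorem Represents.unique (hρ : ρ.IsSubordinate u.U) {y : Y} {p q : StasheffSpace G.toTopCategory}
    (hp : Represents u ρ v y p) (hq : Represents u ρ v y q) : p = q := by
  refine ext_transition (fun n => ?_) fun m n hm hn => ?_
  · by_cases h : ∃ i, ρ i y ≠ 0 ∧ v i = n
    · obtain ⟨i, hi, rfl⟩ := h
      rw [hp.coord_eq i hi, hq.coord_eq i hi]
    · rw [not_imp_comm.1 (hp.exists_of_coord n) h, not_imp_comm.1 (hq.exists_of_coord n) h]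
  · obtain ⟨i, hi, rfl⟩ := hp.exists_of_coord m hm
    obtain ⟨j, hj, rfl⟩ := hp.exists_of_coord n hn
    have mi : y ∈ u.U i := PartitionOfUnity.IsSubordinate.mem hρ hi
    have mj : y ∈ u.U j := PartitionOfUnity.IsSubordinate.mem hρ hj
    rw [hp.transition_eq i j mi mj hi hj, hq.transition_eq i j mi mj hi hj]

/-- Indices `i j` over which `ρ` sums to `1` include all active ones, so that the formula for the
classifying map does not depend on them. -/
theorem represents_mk {k : ℕ} {α : Fin (k + 1) ↪o ℕ} {i : Fin (k + 1) → ι}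
    (hi : ∀ j, v (i j) = α j) {y : Y} (hy : ∀ j, y ∈ u.U (i j)) {t : stdSimplex ℝ (Fin (k + 1))}
    (ht : ∀ j, t j = ρ (i j) y) : Represents u ρ v y (mk α (u.simplexAt i y hy) t) := by
  classical
  have inj : Function.Injective i := fun a b h => α.injective (by rw [← hi, ← hi, h])
  have sum : ∑ a ∈ Finset.univ.image i, ρ a y = 1 := by
    rw [Finset.sum_image fun a _ b _ h => inj h]
    exact (Finset.sum_congr rfl fun j _ => (ht j).symm).trans t.2.2
  have ran : ∀ a, ρ a y ≠ 0 → ∃ j, i j = a := by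
    intro a ha
    by_contra h
    exact ha (PartitionOfUnity.eq_zero_of_sum_eq_one ρ sum (by simpa using h))
  refine ⟨fun a ha => ?_, fun n hn => ?_, fun a b _ _ ha hb => ?_⟩
  · obtain ⟨j, rfl⟩ := ran a ha
    rw [hi, coord_mk_apply, ht]
  · obtain ⟨j, rfl⟩ := exists_of_coord_ne_zero hn
    rw [coord_mk_apply, ht] at hn
    exact ⟨i j, hn, hi j⟩
  · obtain ⟨j, rfl⟩ := ran a ha
    obtain ⟨l, rfl⟩ := ran b hb
    rw [hi, hi, transition_mk_apply _ _ _ (by rwa [ht]) (by rwa [ht]), u.simplexAt_trans]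

theorem exists_enumeration {T : Finset ι} (hT : T.Nonempty) (hv : InjOn v T) :
    ∃ (k : ℕ) (α : Fin (k + 1) ↪o ℕ) (i : Fin (k + 1) → ι),
      (∀ j, v (i j) = α j) ∧ (∀ j, i j ∈ T) ∧ ∀ a ∈ T, ∃ j, i j = a := by
  classical
  obtain ⟨k, hk⟩ : ∃ k, (T.image v).card = k + 1 :=
    Nat.exists_eq_succ_of_ne_zero (Finset.card_ne_zero.2 (hT.image v))
  choose i hi using fun j => Finset.mem_image.1 (Finset.orderEmbOfFin_mem (T.image v) hk j)
  refine ⟨k, (T.image v).orderEmbOfFin hk, i, fun j => (hi j).2, fun j => (hi j).1,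
    fun a ha => ?_⟩
  have : v a ∈ range ((T.image v).orderEmbOfFin hk) := by
    rw [Finset.range_orderEmbOfFin]
    exact Finset.mem_image_of_mem v ha
  obtain ⟨j, hj⟩ := this
  exact ⟨j, hv (hi j).1 ha ((hi j).2.trans hj)⟩

/-- The points at which all members of the partition of unity outside `T` vanish and which lie in
the members of the cover with index in `T`. -/
def activeSet (u : Cocycle G Y ι) (ρ : PartitionOfUnity ι Y univ) (T : Finset ι) : Set Y :=
  {y | (∀ i ∈ T, y ∈ u.U i) ∧ ∀ i ∉ T, ρ i y = 0}

/-- The map into `B G` with the coordinates prescribed by `ρ` and `v` is given by a continuous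
formula on every set `activeSet u ρ T`: there it takes values in a single simplex, with the
vertices `v i` for `i ∈ T`. -/
theorem exists_continuous_represents (T : Finset ι) (hv : InjOn v T) :
    ∃ g : activeSet u ρ T → StasheffSpace G.toTopCategory,
      Continuous g ∧ ∀ y, Represents u ρ v y.1 (g y) := by
  rcases T.eq_empty_or_nonempty with rfl | hT
  · have : IsEmpty (activeSet u ρ ∅) := ⟨fun y => by
      simpa using PartitionOfUnity.sum_finset_eq_one ρ y.2.2⟩
    exact ⟨isEmptyElim, continuous_of_const isEmptyElim, isEmptyElim⟩
  obtain ⟨k, α, i, hi, hiT, hTi⟩ := exists_enumeration hT hv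
  have inj : Function.Injective i := fun a b h => α.injective (by rw [← hi, ← hi, h])
  have sum : ∀ y ∈ activeSet u ρ T, ∑ j, ρ (i j) y = 1 := by
    intro y hy
    rw [← PartitionOfUnity.sum_finset_eq_one ρ hy.2]
    exact Finset.sum_nbij i (fun j _ => hiT j) inj.injOn
      (fun a ha => by simpa using hTi a ha) fun _ _ => rfl
  refine ⟨fun y => mk α (u.simplexAt i y.1 fun j => y.2.1 _ (hiT j))
    ⟨fun j => ρ (i j) y, fun j => ρ.nonneg _ _, sum y y.2⟩, ?_,
    fun y => represents_mk hi _ fun j => rfl⟩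
  refine (continuous_mk α).comp (Continuous.prodMk ?_ ?_)
  · refine Continuous.subtype_mk (continuous_pi fun p => ?_) _
    exact (u.f (i p.1.2) (i p.1.1)).continuous.comp (Continuous.subtype_mk continuous_subtype_val _)
  · exact Continuous.subtype_mk (continuous_pi fun j =>
      (ρ (i j)).continuous.comp continuous_subtype_val) _

/-- A cocycle with a subordinate partition of unity and a colouring of its indices by natural
numbers has a classifying map. Near a point, the sets `activeSet u ρ T`, for finitely many `T`, form
a cover by relatively closed sets. -/
theorem exists_classifyingMap (hρ : ρ.IsSubordinate u.U) (hv : IsColouring ρ v) :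
    ∃ c : C(Y, StasheffSpace G.toTopCategory), ∀ y, Represents u ρ v y (c y) := by
  -- the indices active at `y`
  let T : Y → Finset ι := fun y => (ρ.locallyFinite.point_finite y).toFinset
  have hT : ∀ y i, i ∈ T y ↔ ρ i y ≠ 0 := fun y i => by simp [T]
  have inj : ∀ y, InjOn v (T y) := fun y i hi j hj h =>
    hv y i j ((hT y i).1 hi) ((hT y j).1 hj) h
  have mem : ∀ y, y ∈ activeSet u ρ (T y) := fun y =>
    ⟨fun i hi => PartitionOfUnity.IsSubordinate.mem hρ ((hT y i).1 hi), fun i hi => by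
      rwa [hT, not_not] at hi⟩
  choose g hgc hg using fun (S : Finset ι) (hS : InjOn v S) =>
    exists_continuous_represents (u := u) (ρ := ρ) S hS
  have hc : ∀ y, Represents u ρ v y (g (T y) (inj y) ⟨y, mem y⟩) := fun y => hg _ _ ⟨y, mem y⟩
  refine ⟨⟨fun y => g (T y) (inj y) ⟨y, mem y⟩, ?_⟩, hc⟩
  rw [continuous_iff_continuousAt]
  intro y
  -- on the neighbourhood `N` of `y`, only indices in `S` are active, and `N` lies in their `U i`
  obtain ⟨S, N, hN, hNU, hNS⟩ :=
    ρ.exists_finset_nhds_support_subset hρ (fun i => u.isOpen_U i) y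
  have key : ∀ R ∈ {R : Finset ι | R ⊆ S ∧ InjOn v R},
      ContinuousWithinAt (fun y => g (T y) (inj y) ⟨y, mem y⟩) (activeSet u ρ R) y := by
    rintro R ⟨hRS, hR⟩
    by_cases hy : y ∈ activeSet u ρ R
    · refine (continuousOn_iff_continuous_domRestrict.2 ?_) y hy
      convert hgc R hR using 1
      exact funext fun z => (hc z.1).unique hρ (hg R hR z)
    -- otherwise `y` has a neighbourhood disjoint from `activeSet u ρ R`
    · obtain ⟨i, hi, hi'⟩ : ∃ i, i ∉ R ∧ ρ i y ≠ 0 := by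
        by_contra! h
        exact hy ⟨fun i hi => mem_iInter₂.1 (hNU (mem_of_mem_nhds hN)) i (hRS hi), h⟩
      have ho : {z | ρ i z ≠ 0} ∈ 𝓝 y :=
        (isOpen_ne_fun (ρ i).continuous continuous_const).mem_nhds hi'
      rw [ContinuousWithinAt, show 𝓝[activeSet u ρ R] y = ⊥ from ?_]
      · exact Filter.tendsto_bot
      · rw [← Filter.empty_mem_iff_bot]
        filter_upwards [mem_nhdsWithin_of_mem_nhds ho, self_mem_nhdsWithin] with z hz hz'
        exact hz (hz'.2 i hi)
  have fin : {R : Finset ι | R ⊆ S ∧ InjOn v R}.Finite :=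
    S.powerset.finite_toSet.subset fun R hR => by simpa using hR.1
  have hU : ⋃ R ∈ {R : Finset ι | R ⊆ S ∧ InjOn v R}, activeSet u ρ R ∈ 𝓝 y :=
    Filter.mem_of_superset hN fun z hz => mem_biUnion
      (x := T z) ⟨fun i hi => hNS z hz ((hT z i).1 hi), inj z⟩ (mem z)
  rw [ContinuousAt, ← nhdsWithin_eq_nhds.2 hU, nhdsWithin_biUnion fin]
  simp only [Filter.tendsto_iSup]
  exact key

theorem isClassifyingMap_of_represents (hρ : ρ.IsSubordinate u.U) {e : ι ↪ ℕ}
    {c : C(Y, StasheffSpace G.toTopCategory)} (hc : ∀ y, Represents u ρ e y (c y)) :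
    IsClassifyingMap u ρ e c :=
  fun y _ _ _ hi hy _ ht => (hc y).unique hρ (represents_mk hi hy ht)

/-- The universal cocycle pulls back to `u` along a classifying map of `u`: over the set where the
coordinate at `n` does not vanish, the index of the colour `n` which is active is locally constant,
and the transition morphisms of `u` into this index form an isomorphism. -/
theorem iso_pullback_universalCocycle (hρ : ρ.IsSubordinate u.U) (hv : IsColouring ρ v)
    {c : C(Y, StasheffSpace G.toTopCategory)} (hc : ∀ y, Represents u ρ v y (c y)) :
    u.Iso ((universalCocycle.{w} G).pullback c) := by
  -- `a n y` is the active index of colour `n` at `y`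
  choose a ha hav using fun (n : ULift.{w} ℕ) (y : Y)
    (h : y ∈ ((universalCocycle.{w} G).pullback c).U n) =>
      (hc y).exists_of_coord n.down (ne_of_gt h)
  have hm : ∀ n y h, y ∈ u.U (a n y h) := fun n y h =>
    PartitionOfUnity.IsSubordinate.mem hρ (ha n y h)
  let φ : (n : ULift.{w} ℕ) → (i : ι) →
      C(↥(u.U i ∩ ((universalCocycle.{w} G).pullback c).U n), M) := fun n i =>
    ⟨fun y => u.f (a n y y.2.2) i ⟨y, y.2.1, hm n y y.2.2⟩, by
      rw [continuous_iff_continuousAt]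
      intro y
      have ho : IsOpen {z : ↥(u.U i ∩ ((universalCocycle.{w} G).pullback c).U n) |
          ρ (a n y y.2.2) z ≠ 0} :=
        isOpen_ne_fun ((ρ _).continuous.comp continuous_subtype_val) continuous_const
      refine ContinuousOn.continuousAt ?_ (ho.mem_nhds (ha n y y.2.2))
      rw [continuousOn_iff_continuous_domRestrict]
      have e : ∀ z : {z : ↥(u.U i ∩ ((universalCocycle.{w} G).pullback c).U n) |
          ρ (a n y y.2.2) z ≠ 0}, a n z.1 z.1.2.2 = a n y y.2.2 := fun z =>
        hv z.1 _ _ (ha n z.1 z.1.2.2) z.2 ((hav _ _ _).trans (hav _ _ _).symm)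
      have hz : ∀ z : {z : ↥(u.U i ∩ ((universalCocycle.{w} G).pullback c).U n) |
          ρ (a n y y.2.2) z ≠ 0}, (z.1 : Y) ∈ u.U (a n y y.2.2) := fun z =>
        PartitionOfUnity.IsSubordinate.mem hρ z.2
      have : Continuous fun z : {z : ↥(u.U i ∩ ((universalCocycle.{w} G).pullback c).U n) |
          ρ (a n y y.2.2) z ≠ 0} => u.f (a n y y.2.2) i ⟨z.1, z.1.2.1, hz z⟩ :=
        (u.f _ _).continuous.comp (Continuous.subtype_mk
          (continuous_subtype_val.comp continuous_subtype_val) _)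
      convert this using 1
      funext z
      have : ∀ j (h : j = a n y y.2.2) (hj : (z.1 : Y) ∈ u.U j),
          u.f j i ⟨z.1, z.1.2.1, hj⟩ = u.f (a n y y.2.2) i ⟨z.1, z.1.2.1, hz z⟩ := by
        rintro _ rfl _
        rfl
      exact this _ (e z) (hm n z.1 z.1.2.2)⟩
  refine ⟨φ, (Cocycle.iso_iff φ).2 ⟨?_, ?_⟩⟩
  · intro i m n y hi hm' hn'
    have := u.comp_f i (a m y hm') (a n y hn') y hi (hm _ _ _) (hm _ _ _)
    rw [← (hc y).transition_eq _ _ (hm m y hm') (hm n y hn') (ha _ _ _) (ha _ _ _), hav,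
      hav] at this
    exact this
  · intro i j n y hi hj hn'
    exact u.comp_f i j (a n y hn') y hi hj (hm _ _ _)

end Classifying

/-! ### Reduction to countable covers -/

section Classifying

variable {O M : Type*} [TopologicalSpace O] [TopologicalSpace M] {G : TopGroupoid O M}
  {Y : Type*} [TopologicalSpace Y] {ι : Type*}

/-- The function `max 0 (min_{i ∈ S} ρ i - ∑_{j ∉ S} ρ j)`, written as a finite expression in the
`ρ i` with `i ∈ S`. -/
def dominance (ρ : PartitionOfUnity ι Y univ) (S : {S : Finset ι // S.Nonempty}) : C(Y, ℝ) :=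
  ⟨fun y => max 0 (S.1.inf' S.2 (fun i => ρ i y) - (1 - ∑ i ∈ S.1, ρ i y)),
    continuous_const.max ((Continuous.finset_inf'_apply S.2 fun i _ => (ρ i).continuous).sub
      (continuous_const.sub (continuous_finsetSum _ fun i _ => (ρ i).continuous)))⟩

theorem lt_of_dominance_ne_zero {ρ : PartitionOfUnity ι Y univ}
    {S : {S : Finset ι // S.Nonempty}} {y : Y} (h : dominance ρ S y ≠ 0) {i : ι} (hi : i ∈ S.1) :
    1 - ∑ i ∈ S.1, ρ i y < ρ i y := by
  by_contra! h'
  refine h (max_eq_left (sub_nonpos.2 ?_))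
  exact (Finset.inf'_le _ hi).trans h'

theorem ne_zero_of_dominance_ne_zero {ρ : PartitionOfUnity ι Y univ}
    {S : {S : Finset ι // S.Nonempty}} {y : Y} (h : dominance ρ S y ≠ 0) {i : ι} (hi : i ∈ S.1) :
    ρ i y ≠ 0 := by
  have h1 := lt_of_dominance_ne_zero h hi
  have h2 := PartitionOfUnity.sum_finset_le_one ρ S.1 y
  exact ne_of_gt (by linarith)

theorem locallyFinite_dominance (ρ : PartitionOfUnity ι Y univ) :
    LocallyFinite fun S => Function.support (dominance ρ S) := by
  intro y
  obtain ⟨N, hN, hf⟩ := ρ.locallyFinite y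
  refine ⟨N, hN, (hf.toFinset.powerset.finite_toSet.preimage
    Subtype.val_injective.injOn).subset ?_⟩
  rintro S ⟨z, hz, hzN⟩
  simp only [mem_preimage, Finset.mem_coe, Finset.mem_powerset]
  intro i hi
  exact hf.mem_toFinset.2 ⟨z, ne_zero_of_dominance_ne_zero hz hi, hzN⟩

/-- The set of all indices active at a point dominates there. -/
theorem exists_dominance_ne_zero (ρ : PartitionOfUnity ι Y univ) (y : Y) :
    ∃ S, dominance ρ S y ≠ 0 := by
  let T : Finset ι := (ρ.locallyFinite.point_finite y).toFinset
  have hT : ∀ i, i ∈ T ↔ ρ i y ≠ 0 := fun i => by simp [T]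
  have sum : ∑ i ∈ T, ρ i y = 1 :=
    PartitionOfUnity.sum_finset_eq_one ρ fun i hi => by rwa [hT, not_not] at hi
  have ne : T.Nonempty := by
    rw [Finset.nonempty_iff_ne_empty]
    intro h
    rw [h] at sum
    simp at sum
  refine ⟨⟨T, ne⟩, ne_of_gt (lt_max_of_lt_right ?_)⟩
  rw [sum, sub_self, sub_zero, Finset.lt_inf'_iff]
  exact fun i hi => (ρ.nonneg i y).lt_of_ne' ((hT i).1 hi)

/-- Two sets of the same size which dominate at the same point are equal: if `i ∈ S \ T` and
`j ∈ T \ S`, then `ρ j y < ρ i y` and `ρ i y < ρ j y`. -/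
theorem eq_of_dominance_ne_zero {ρ : PartitionOfUnity ι Y univ}
    {S T : {S : Finset ι // S.Nonempty}} {y : Y} (hS : dominance ρ S y ≠ 0)
    (hT : dominance ρ T y ≠ 0) (h : S.1.card = T.1.card) : S = T := by
  by_contra hne
  have h1 : ¬ S.1 ⊆ T.1 := fun h' => hne (Subtype.ext (Finset.eq_of_subset_of_card_le h' h.ge))
  have h2 : ¬ T.1 ⊆ S.1 := fun h' =>
    hne (Subtype.ext (Finset.eq_of_subset_of_card_le h' h.le).symm)
  obtain ⟨i, hi, hi'⟩ := Finset.not_subset.1 h1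
  obtain ⟨j, hj, hj'⟩ := Finset.not_subset.1 h2
  classical
  have k1 := PartitionOfUnity.sum_finset_le_one ρ (insert j S.1) y
  have k2 := PartitionOfUnity.sum_finset_le_one ρ (insert i T.1) y
  rw [Finset.sum_insert hj'] at k1
  rw [Finset.sum_insert hi'] at k2
  have l1 := lt_of_dominance_ne_zero hS hi
  have l2 := lt_of_dominance_ne_zero hT hj
  linarith

/-- Every numerable cocycle is isomorphic to a pullback of the universal cocycle. The index set is
made countable by passing to the sets of points at which a given finite set `S` of indices
dominates all others, and by giving such a set the colour `#S`. -/
theorem Cocycle.IsNumerable.exists_iso_pullback {u : Cocycle G Y ι} (hu : u.IsNumerable) :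
    ∃ c : C(Y, StasheffSpace G.toTopCategory), u.Iso ((universalCocycle.{w} G).pullback c) := by
  obtain ⟨ρ, hρ⟩ := hu
  obtain ⟨σ, hσ⟩ := exists_partitionOfUnity_support_eq (dominance ρ) (locallyFinite_dominance ρ)
    (fun S y => le_max_left _ _) (exists_dominance_ne_zero ρ)
  have hσ' : ∀ {S y}, σ S y ≠ 0 → dominance ρ S y ≠ 0 := fun {S y} h => (hσ S).subset h
  have hg : ∀ y, ∃ S : {S : Finset ι // S.Nonempty}, y ∈ u.U S.2.choose := by
    intro y
    obtain ⟨S, hS⟩ := exists_dominance_ne_zero ρ y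
    exact ⟨S, PartitionOfUnity.IsSubordinate.mem hρ
      (ne_zero_of_dominance_ne_zero hS S.2.choose_spec)⟩
  have hsub : σ.IsSubordinate (u.reindex (fun S => S.2.choose) hg).U := by
    intro S
    refine (closure_mono ?_).trans (hρ S.2.choose)
    exact fun y hy => ne_zero_of_dominance_ne_zero (hσ' hy) S.2.choose_spec
  have hcol : IsColouring σ fun S => S.1.card := fun y S T hS hT h =>
    eq_of_dominance_ne_zero (hσ' hS) (hσ' hT) h
  obtain ⟨c, hc⟩ := exists_classifyingMap hsub hcol
  exact ⟨c, (u.iso_reindex _ hg).trans (iso_pullback_universalCocycle hsub hcol hc)⟩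

end Classifying

/-! ### Making the coordinates locally finite -/

section Homotopies

variable {O M : Type*} [TopologicalSpace O] [TopologicalSpace M] {G : TopGroupoid O M}
  {X Y : Type*} [TopologicalSpace X] [TopologicalSpace Y] {ι κ : Type*}

open StasheffSpace

theorem homotopic_of_slice {c₀ c₁ : C(Y, X)} (C : C(Y × unitInterval, X))
    (h₀ : ∀ y, C (y, 0) = c₀ y) (h₁ : ∀ y, C (y, 1) = c₁ y) : c₀.Homotopic c₁ :=
  ⟨⟨C.comp ⟨Prod.swap, continuous_swap⟩, h₀, h₁⟩⟩

theorem PartitionOfUnity.exists_pullback (ρ : PartitionOfUnity ι Y univ) {U : ι → Set Y}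
    (hρ : ρ.IsSubordinate U) (h : C(X, Y)) : ∃ σ : PartitionOfUnity ι X univ,
      σ.IsSubordinate (fun i => h ⁻¹' U i) ∧ ∀ i x, σ i x = ρ i (h x) := by
  refine ⟨⟨fun i => (ρ i).comp h, ρ.locallyFinite.preimage_continuous h.continuous,
    fun i x => ρ.nonneg i (h x), fun x _ => ρ.sum_eq_one (mem_univ (h x)),
    fun x => ρ.sum_le_one (h x)⟩, fun i => ?_, fun _ _ => rfl⟩
  refine Subset.trans ?_ (preimage_mono (hρ i))
  exact closure_minimal (fun x hx => subset_tsupport (ρ i) hx)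
    ((isClosed_tsupport (ρ i)).preimage h.continuous)

/-- A point of `B G` which represents `u` at `h x` represents the pullback of `u` at `x`. -/
theorem Represents.comp {u : Cocycle G Y ι} {ρ : PartitionOfUnity ι Y univ} {v : ι → ℕ}
    {h : C(X, Y)} {σ : PartitionOfUnity ι X univ} (hσ : ∀ i x, σ i x = ρ i (h x)) {x : X}
    {p : StasheffSpace G.toTopCategory} (hp : Represents u ρ v (h x) p) :
    Represents (u.pullback h) σ v x p where
  coord_eq i hi := by
    rw [hσ] at hi ⊢
    exact hp.coord_eq i hi
  exists_of_coord n hn := by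
    simpa only [hσ] using hp.exists_of_coord n hn
  transition_eq i j hi hj hi' hj' := by
    rw [hσ] at hi' hj'
    exact hp.transition_eq i j hi hj hi' hj'

/-- The point `q` lies on a simplex of `p` and divides the segment from `p` to the point with
coordinates `ρ n p` in the ratio `τ : 1 - τ`. -/
structure IsMixture (ρ : PartitionOfUnity (ULift.{w} ℕ) (StasheffSpace G.toTopCategory) univ)
    (τ : ℝ) (p q : StasheffSpace G.toTopCategory) : Prop where
  coord_eq : ∀ n, coord n q = (1 - τ) * coord n p + τ * ρ ⟨n⟩ p
  transition_eq : ∀ m n, coord m q ≠ 0 → coord n q ≠ 0 → transition m n q = transition m n p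

theorem IsMixture.unique
    {ρ : PartitionOfUnity (ULift.{w} ℕ) (StasheffSpace G.toTopCategory) univ} {τ : ℝ}
    {p q q' : StasheffSpace G.toTopCategory} (h : IsMixture ρ τ p q) (h' : IsMixture ρ τ p q') :
    q = q' := by
  refine ext_transition (fun n => (h.coord_eq n).trans (h'.coord_eq n).symm) fun m n hm hn => ?_
  rw [h.transition_eq m n hm hn, h'.transition_eq m n]
  · rwa [h'.coord_eq, ← h.coord_eq]
  · rwa [h'.coord_eq, ← h.coord_eq]

variable {ρ : PartitionOfUnity (ULift.{w} ℕ) (StasheffSpace G.toTopCategory) univ}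

theorem apply_mk_of_notMem (hρ : ρ.IsSubordinate (universalCocycle.{w} G).U) {k : ℕ}
    (α : Fin (k + 1) ↪o ℕ) (F : Nerve G.toTopCategory k) (t : stdSimplex ℝ (Fin (k + 1))) {n : ℕ}
    (hn : ∀ j, α j ≠ n) : ρ ⟨n⟩ (mk α F t) = 0 := by
  by_contra h
  have h : 0 < coord n (mk α F t) := PartitionOfUnity.IsSubordinate.mem hρ h
  exact h.ne' (coord_mk_of_notMem α F t hn)

theorem sum_apply_mk (hρ : ρ.IsSubordinate (universalCocycle.{w} G).U) {k : ℕ}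
    (α : Fin (k + 1) ↪o ℕ) (F : Nerve G.toTopCategory k) (t : stdSimplex ℝ (Fin (k + 1))) :
    ∑ j, ρ ⟨α j⟩ (mk α F t) = 1 := by
  classical
  have inj : Function.Injective fun j => (⟨α j⟩ : ULift.{w} ℕ) :=
    ULift.up_injective.comp α.injective
  rw [← PartitionOfUnity.sum_finset_eq_one ρ
    (s := Finset.univ.image fun j => (⟨α j⟩ : ULift.{w} ℕ)), Finset.sum_image inj.injOn]
  rintro ⟨n⟩ hn
  refine apply_mk_of_notMem hρ α F t fun j hj => hn ?_
  rw [← hj]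
  exact Finset.mem_image_of_mem _ (Finset.mem_univ j)

/-- The barycentric coordinates of the mixture. -/
def mixture (hρ : ρ.IsSubordinate (universalCocycle.{w} G).U) {k : ℕ} (α : Fin (k + 1) ↪o ℕ)
    (F : Nerve G.toTopCategory k) (t : stdSimplex ℝ (Fin (k + 1))) (τ : unitInterval) :
    stdSimplex ℝ (Fin (k + 1)) :=
  ⟨fun j => (1 - τ) * t j + τ * ρ ⟨α j⟩ (mk α F t), fun j =>
    add_nonneg (mul_nonneg (sub_nonneg.2 τ.2.2) (t.2.1 j)) (mul_nonneg τ.2.1 (ρ.nonneg _ _)), by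
    have h : ∑ j, t j = 1 := t.2.2
    rw [Finset.sum_add_distrib, ← Finset.mul_sum, ← Finset.mul_sum, sum_apply_mk hρ, h]
    ring⟩

theorem isMixture_mk (hρ : ρ.IsSubordinate (universalCocycle.{w} G).U) {k : ℕ}
    (α : Fin (k + 1) ↪o ℕ) (F : Nerve G.toTopCategory k) (t : stdSimplex ℝ (Fin (k + 1)))
    (τ : unitInterval) : IsMixture ρ τ (mk α F t) (mk α F (mixture hρ α F t τ)) := by
  refine ⟨fun n => ?_, fun m n hm hn => ?_⟩
  · by_cases h : ∃ j, α j = n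
    · obtain ⟨j, rfl⟩ := h
      rw [coord_mk_apply, coord_mk_apply]
      rfl
    · push Not at h
      rw [coord_mk_of_notMem _ _ _ h, coord_mk_of_notMem _ _ _ h, apply_mk_of_notMem hρ α F t h]
      ring
  · obtain ⟨j, rfl⟩ := exists_of_coord_ne_zero hm
    obtain ⟨l, rfl⟩ := exists_of_coord_ne_zero hn
    -- as `ρ` is subordinate, a vertex of the mixture is a vertex of the given point
    have key : ∀ j, mixture hρ α F t τ j ≠ 0 → t j ≠ 0 := by
      intro j hj h
      refine hj ?_
      have h' : ρ ⟨α j⟩ (mk α F t) = 0 := by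
        by_contra h'
        have h' : 0 < coord (α j) (mk α F t) := PartitionOfUnity.IsSubordinate.mem hρ h'
        rw [coord_mk_apply] at h'
        exact h'.ne' h
      change (1 - (τ : ℝ)) * t j + τ * ρ ⟨α j⟩ (mk α F t) = 0
      rw [h, h']
      ring
    rw [coord_mk_apply] at hm hn
    rw [transition_mk_apply α F _ hm hn, transition_mk_apply α F t (key j hm) (key l hn)]

/-- The identity of `B G` is homotopic to a map whose coordinates form a locally finite partition of
unity. The homotopy is linear on every simplex; it is continuous as `B G × [0, 1]` carries the
quotient topology. -/
theorem exists_homotopic_id (hρ : ρ.IsSubordinate (universalCocycle.{w} G).U) :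
    ∃ r : C(StasheffSpace G.toTopCategory, StasheffSpace G.toTopCategory),
      (ContinuousMap.id _).Homotopic r ∧
        ∀ p, Represents (universalCocycle.{w} G) ρ ULift.down p (r p) := by
  have ex : ∀ (p : StasheffSpace G.toTopCategory) (τ : unitInterval), ∃ q, IsMixture ρ τ p q := by
    intro p τ
    obtain ⟨k, α, F, t, rfl⟩ := exists_mk p
    exact ⟨_, isMixture_mk hρ α F t τ⟩
  choose H hH using ex
  have hc : Continuous fun x : StasheffSpace G.toTopCategory × unitInterval => H x.1 x.2 := by
    refine isQuotientMap_proj.continuous_lift_prod_left ?_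
    rw [← (Homeomorph.sigmaProdDistrib (X := fun a : (Σ k : ℕ, Fin (k + 1) ↪o ℕ) =>
      Nerve G.toTopCategory a.1 × stdSimplex ℝ (Fin (a.1 + 1)))).symm.comp_continuous_iff']
    refine continuous_sigma fun a => ?_
    have e : ∀ x : (Nerve G.toTopCategory a.1 × stdSimplex ℝ (Fin (a.1 + 1))) × unitInterval,
        H (mk a.2 x.1.1 x.1.2) x.2 =
          mk a.2 x.1.1 (mixture hρ a.2 x.1.1 x.1.2 x.2) := fun x =>
      (hH _ _).unique (isMixture_mk hρ _ _ _ _)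
    have hm : Continuous fun x : (Nerve G.toTopCategory a.1 × stdSimplex ℝ (Fin (a.1 + 1))) ×
        unitInterval => mixture hρ a.2 x.1.1 x.1.2 x.2 := by
      refine Continuous.subtype_mk (continuous_pi fun j => ?_) _
      have h1 : Continuous fun x : (Nerve G.toTopCategory a.1 × stdSimplex ℝ (Fin (a.1 + 1))) ×
          unitInterval => (x.2 : ℝ) := continuous_subtype_val.comp continuous_snd
      have h2 : Continuous fun x : (Nerve G.toTopCategory a.1 × stdSimplex ℝ (Fin (a.1 + 1))) ×
          unitInterval => x.1.2 j :=
        (continuous_simplex_apply j).comp (continuous_snd.comp continuous_fst)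
      have h3 : Continuous fun x : (Nerve G.toTopCategory a.1 × stdSimplex ℝ (Fin (a.1 + 1))) ×
          unitInterval => ρ ⟨a.2 j⟩ (mk a.2 x.1.1 x.1.2) :=
        (ρ _).continuous.comp ((continuous_mk a.2).comp continuous_fst)
      exact ((continuous_const.sub h1).mul h2).add (h1.mul h3)
    exact (continuous_congr e).2 ((continuous_mk a.2).comp
      ((continuous_fst.comp continuous_fst).prodMk hm))
  have h1 : ∀ p n, coord n (H p 1) = ρ ⟨n⟩ p := fun p n => by
    rw [(hH p 1).coord_eq]
    simp
  refine ⟨⟨fun p => H p 1, hc.comp (Continuous.prodMk continuous_id continuous_const)⟩,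
    homotopic_of_slice ⟨_, hc⟩ (fun p => ?_) fun _ => rfl, fun p => ⟨fun n _ => h1 p n.down,
      fun n hn => ⟨⟨n⟩, (h1 p n).symm.trans_ne hn, rfl⟩, fun m n _ _ hm hn => ?_⟩⟩
  · exact (hH p 0).unique ⟨fun n => by simp, fun m n _ _ => rfl⟩
  · exact (hH p 1).transition_eq _ _ ((h1 p _).trans_ne hm) ((h1 p _).trans_ne hn)

end Homotopies

/-! ### Moving coordinates along an isomorphism of cocycles -/

section Homotopies

variable {O M : Type*} [TopologicalSpace O] [TopologicalSpace M] {G : TopGroupoid O M}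
  {X Y : Type*} [TopologicalSpace X] [TopologicalSpace Y] {ι κ : Type*}

open StasheffSpace

theorem finsum_sum_type {ι κ : Type*} {f : ι ⊕ κ → ℝ}
    (h₁ : (Function.support fun i => f (Sum.inl i)).Finite)
    (h₂ : (Function.support fun j => f (Sum.inr j)).Finite) :
    ∑ᶠ i, f i = ∑ᶠ i, f (Sum.inl i) + ∑ᶠ j, f (Sum.inr j) := by
  rw [finsum_eq_sum_of_support_subset (s := h₁.toFinset.disjSum h₂.toFinset), Finset.sum_disjSum,
    ← finsum_eq_sum _ h₁, ← finsum_eq_sum _ h₂]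
  rintro (i | i) hi
  · simpa using hi
  · simpa using hi

/-- The classifying maps of isomorphic cocycles are homotopic if weights can be moved from the
members of the first to those of the second in such a way that, at any time, no vertex is used by
both of them. The homotopy is the classifying map of the cocycle on `Y × [0, 1]` obtained from the
two cocycles by gluing. -/
theorem homotopic_of_weights {u : Cocycle G Y ι} {v : Cocycle G Y κ} (huv : u.Iso v)
    {ρ : PartitionOfUnity ι Y univ} {σ : PartitionOfUnity κ Y univ} (hρ : ρ.IsSubordinate u.U)
    (hσ : σ.IsSubordinate v.U) {a : ι → ℕ} {b : κ → ℕ} (ha : IsColouring ρ a)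
    (hb : IsColouring σ b) (θ : ι → C(unitInterval, ℝ)) (η : κ → C(unitInterval, ℝ))
    (θ_nonneg : ∀ i τ, 0 ≤ θ i τ) (η_nonneg : ∀ i τ, 0 ≤ η i τ)
    (θ_zero : ∀ i, θ i 0 = 1) (θ_one : ∀ i, θ i 1 = 0)
    (η_zero : ∀ i, η i 0 = 0) (η_one : ∀ i, η i 1 = 1)
    (hsum : ∀ y τ, ∑ᶠ i, ρ i y * θ i τ + ∑ᶠ j, σ j y * η j τ = 1)
    (hab : ∀ i j τ, θ i τ ≠ 0 → η j τ ≠ 0 → a i ≠ b j)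
    {c₀ c₁ : C(Y, StasheffSpace G.toTopCategory)} (h₀ : ∀ y, Represents u ρ a y (c₀ y))
    (h₁ : ∀ y, Represents v σ b y (c₁ y)) : c₀.Homotopic c₁ := by
  obtain ⟨φ, hφ⟩ := huv
  obtain ⟨p1, p2⟩ := (Cocycle.iso_iff φ).1 hφ
  let pr : C(Y × unitInterval, Y) := ⟨Prod.fst, continuous_fst⟩
  let W : Cocycle G (Y × unitInterval) (ι ⊕ κ) := (Cocycle.glue u v univ univ isOpen_univ
    isOpen_univ (fun _ => Or.inl trivial)
    (fun j i => ⟨fun y => φ j i ⟨y.1, y.2.1.1, y.2.2.1⟩, by fun_prop⟩)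
    (fun i j l y hi hj hl => p1 i j l y hi.1 hj.1 hl.1)
    (fun i j l y hi hj hl => p2 i j l y hi.1 hj.1 hl.1)).pullback pr
  let π : ι ⊕ κ → C(Y × unitInterval, ℝ) := Sum.elim
    (fun i => ⟨fun y => ρ i y.1 * θ i y.2, by fun_prop⟩)
    (fun j => ⟨fun y => σ j y.1 * η j y.2, by fun_prop⟩)
  have hl : ∀ i y, π (Sum.inl i) y ≠ 0 → ρ i y.1 ≠ 0 ∧ θ i y.2 ≠ 0 := fun i y => mul_ne_zero_iff.1
  have hr : ∀ j y, π (Sum.inr j) y ≠ 0 → σ j y.1 ≠ 0 ∧ η j y.2 ≠ 0 := fun i y => mul_ne_zero_iff.1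
  have sum : ∀ y, ∑ᶠ i, π i y = 1 := by
    intro y
    rw [finsum_sum_type, ← hsum y.1 y.2]
    · rfl
    · exact (ρ.locallyFinite.point_finite y.1).subset fun i hi => (hl i y hi).1
    · exact (σ.locallyFinite.point_finite y.1).subset fun i hi => (hr i y hi).1
  have lf : LocallyFinite fun i => Function.support (π i) := by
    have l1 : LocallyFinite fun i => Function.support (π (Sum.inl i)) :=
      (ρ.locallyFinite.preimage_continuous continuous_fst).subset fun i y hy => (hl i y hy).1
    have l2 : LocallyFinite fun i => Function.support (π (Sum.inr i)) :=
      (σ.locallyFinite.preimage_continuous continuous_fst).subset fun i y hy => (hr i y hy).1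
    convert l1.sumElim l2 using 2 with i
    rcases i with i | i <;> rfl
  let P : PartitionOfUnity (ι ⊕ κ) (Y × unitInterval) univ :=
    ⟨π, lf, by
      rintro (i | j) y
      · exact mul_nonneg (ρ.nonneg _ _) (θ_nonneg _ _)
      · exact mul_nonneg (σ.nonneg _ _) (η_nonneg _ _), fun y _ => sum y, fun y => (sum y).le⟩
  have hP : P.IsSubordinate W.U := by
    rintro (i | j)
    · refine (closure_minimal (t := Prod.fst ⁻¹' tsupport (ρ i))
        (fun y hy => subset_tsupport _ (hl i y hy).1)
        ((isClosed_tsupport _).preimage continuous_fst)).trans fun y hy => ⟨hρ i hy, trivial⟩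
    · refine (closure_minimal (t := Prod.fst ⁻¹' tsupport (σ j))
        (fun y hy => subset_tsupport _ (hr j y hy).1)
        ((isClosed_tsupport _).preimage continuous_fst)).trans fun y hy => ⟨hσ j hy, trivial⟩
  have hcol : IsColouring P (Sum.elim a b) := by
    rintro y (i | i) (j | j) hi hj h
    · exact congrArg _ (ha y.1 i j (hl i y hi).1 (hl j y hj).1 h)
    · exact absurd h (hab i j y.2 (hl i y hi).2 (hr j y hj).2)
    · exact absurd h.symm (hab j i y.2 (hl j y hj).2 (hr i y hi).2)
    · exact congrArg _ (hb y.1 i j (hr i y hi).1 (hr j y hj).1 h)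
  obtain ⟨C, hC⟩ := exists_classifyingMap hP hcol
  refine homotopic_of_slice C (fun y => ?_) fun y => ?_
  -- at time `0` only the indices of `u` are active, and at time `1` only those of `v`
  · have e1 : ∀ i, P (Sum.inl i) (y, 0) = ρ i y := fun i =>
      (congrArg (ρ i y * ·) (θ_zero i)).trans (mul_one _)
    have e2 : ∀ i, P (Sum.inr i) (y, 0) = 0 := fun i =>
      (congrArg (σ i y * ·) (η_zero i)).trans (mul_zero _)
    refine Represents.unique (v := a) hρ ⟨fun i hi => ?_, fun n hn => ?_, fun i j mi mj hi hj => ?_⟩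
      (h₀ y)
    · rw [← e1] at hi ⊢
      exact (hC (y, 0)).coord_eq (Sum.inl i) hi
    · obtain ⟨i | j, hi, hn⟩ := (hC (y, 0)).exists_of_coord n hn
      · exact ⟨i, by rwa [← e1], hn⟩
      · exact absurd (e2 j) hi
    · rw [← e1] at hi hj
      exact (hC (y, 0)).transition_eq (Sum.inl i) (Sum.inl j) ⟨mi, trivial⟩ ⟨mj, trivial⟩ hi hj
  · have e1 : ∀ i, P (Sum.inr i) (y, 1) = σ i y := fun i =>
      (congrArg (σ i y * ·) (η_one i)).trans (mul_one _)
    have e2 : ∀ i, P (Sum.inl i) (y, 1) = 0 := fun i =>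
      (congrArg (ρ i y * ·) (θ_one i)).trans (mul_zero _)
    refine Represents.unique (v := b) hσ ⟨fun i hi => ?_, fun n hn => ?_, fun i j mi mj hi hj => ?_⟩
      (h₁ y)
    · rw [← e1] at hi ⊢
      exact (hC (y, 1)).coord_eq (Sum.inr i) hi
    · obtain ⟨i | j, hi, hn⟩ := (hC (y, 1)).exists_of_coord n hn
      · exact absurd (e2 i) hi
      · exact ⟨j, by rwa [← e1], hn⟩
    · rw [← e1] at hi hj
      exact (hC (y, 1)).transition_eq (Sum.inr i) (Sum.inr j) ⟨mi, trivial⟩ ⟨mj, trivial⟩ hi hj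

/-- The piecewise linear function on `[0, 1]` which is `0` up to `1 / (n + 2)` and `1` from
`1 / (n + 1)` on. -/
def delay (n : ℕ) : C(unitInterval, ℝ) :=
  ⟨fun τ => max 0 (min 1 ((n + 1) * ((n + 2) * τ - 1))), by fun_prop⟩

theorem delay_nonneg (n : ℕ) (τ : unitInterval) : 0 ≤ delay n τ := le_max_left _ _

theorem delay_le_one (n : ℕ) (τ : unitInterval) : delay n τ ≤ 1 :=
  max_le zero_le_one (min_le_left _ _)

theorem delay_zero (n : ℕ) : delay n 0 = 0 := by
  refine max_eq_left ((min_le_right _ _).trans ?_)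
  have : (0 : ℝ) ≤ n := n.cast_nonneg
  simp only [Icc.coe_zero]
  linarith

theorem delay_eq_one {n : ℕ} {τ : unitInterval} (h : 1 ≤ (n + 1) * (τ : ℝ)) : delay n τ = 1 := by
  have h0 : (0 : ℝ) ≤ n := n.cast_nonneg
  have : (1 : ℝ) ≤ (n + 1) * ((n + 2) * τ - 1) := by
    have := mul_le_mul_of_nonneg_left h (by linarith : (0 : ℝ) ≤ n + 2)
    linarith
  change max 0 (min 1 ((n + 1) * ((n + 2) * (τ : ℝ) - 1))) = 1
  rw [min_eq_left this, max_eq_right zero_le_one]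

theorem delay_one (n : ℕ) : delay n 1 = 1 := by
  refine delay_eq_one ?_
  simp

/-- The function `delay n` has reached `1` before `delay m` becomes positive, for `m < n`. -/
theorem delay_eq_one_of_lt {m n : ℕ} {τ : unitInterval} (h : delay m τ ≠ 0) (hmn : m < n) :
    delay n τ = 1 := by
  have h0 : (0 : ℝ) ≤ m := m.cast_nonneg
  have h1 : (m : ℝ) + 1 ≤ n := by exact_mod_cast hmn
  have h2 : 1 < (m + 2) * (τ : ℝ) := by
    by_contra! h'
    exact h (max_eq_left ((min_le_right _ _).trans
      (mul_nonpos_of_nonneg_of_nonpos (by linarith) (by linarith))))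
  refine delay_eq_one (h2.le.trans ?_)
  exact mul_le_mul_of_nonneg_right (by linarith) τ.2.1

/-- The vertices can be moved from `a i` to `2 a i + d`. The weight at `a i` moves to `2 a i + d`
during the time `[1 / (a i + 2), 1 / (a i + 1)]`, so that large vertices move first. The vertex
`2 a j + d`, being larger than `a j`, is left before the weight at `a j` starts to move there. -/
theorem homotopic_double {u : Cocycle G Y ι} {ρ : PartitionOfUnity ι Y univ}
    (hρ : ρ.IsSubordinate u.U) {a : ι → ℕ} (ha : Function.Injective a) {d : ℕ} (hd : 0 < d)
    {c₀ c₁ : C(Y, StasheffSpace G.toTopCategory)} (h₀ : ∀ y, Represents u ρ a y (c₀ y))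
    (h₁ : ∀ y, Represents u ρ (fun i => 2 * a i + d) y (c₁ y)) : c₀.Homotopic c₁ := by
  refine homotopic_of_weights (Cocycle.Iso.refl u) hρ hρ (fun _ _ _ _ _ h => ha h)
    (fun _ i j _ _ h => ha (by have h : 2 * a i + d = 2 * a j + d := h; omega))
    (fun i => 1 - delay (a i)) (fun i => delay (a i))
    (fun i τ => sub_nonneg.2 (delay_le_one _ _)) (fun i τ => delay_nonneg _ _)
    (fun i => (congrArg (1 - ·) (delay_zero _)).trans (sub_zero 1))
    (fun i => (congrArg (1 - ·) (delay_one _)).trans (sub_self 1))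
    (fun i => delay_zero _) (fun i => delay_one _) (fun y τ => ?_) (fun i j τ hi hj h => ?_) h₀ h₁
  · have hf := ρ.locallyFinite.point_finite y
    rw [← finsum_add_distrib, ← ρ.sum_eq_one (mem_univ y)]
    · refine finsum_congr fun i => ?_
      change ρ i y * (1 - delay (a i) τ) + ρ i y * delay (a i) τ = ρ i y
      ring
    · exact hf.subset fun i hi => left_ne_zero_of_mul hi
    · exact hf.subset fun i hi => left_ne_zero_of_mul hi
  · refine hi ?_
    change 1 - delay (a i) τ = 0
    rw [delay_eq_one_of_lt hj (by omega), sub_self]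

/-- Classifying maps of isomorphic cocycles with injective numberings are homotopic: their vertices
can be moved to odd and to even numbers, respectively, and then the coordinates can be moved
linearly. -/
theorem homotopic_of_iso_of_represents {u : Cocycle G Y ι} {v : Cocycle G Y κ} (huv : u.Iso v)
    {ρ : PartitionOfUnity ι Y univ} {σ : PartitionOfUnity κ Y univ} (hρ : ρ.IsSubordinate u.U)
    (hσ : σ.IsSubordinate v.U) {a : ι → ℕ} {b : κ → ℕ} (ha : Function.Injective a)
    (hb : Function.Injective b) {c₀ c₁ : C(Y, StasheffSpace G.toTopCategory)}
    (h₀ : ∀ y, Represents u ρ a y (c₀ y)) (h₁ : ∀ y, Represents v σ b y (c₁ y)) :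
    c₀.Homotopic c₁ := by
  have ha' : IsColouring ρ fun i => 2 * a i + 1 := fun _ i j _ _ h =>
    ha (by have h : 2 * a i + 1 = 2 * a j + 1 := h; omega)
  have hb' : IsColouring σ fun i => 2 * b i + 2 := fun _ i j _ _ h =>
    hb (by have h : 2 * b i + 2 = 2 * b j + 2 := h; omega)
  obtain ⟨d₀, hd₀⟩ := exists_classifyingMap hρ ha'
  obtain ⟨d₁, hd₁⟩ := exists_classifyingMap hσ hb'
  refine (homotopic_double hρ ha one_pos h₀ hd₀).trans (ContinuousMap.Homotopic.trans ?_
    (homotopic_double hσ hb two_pos h₁ hd₁).symm)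
  let id' : C(unitInterval, ℝ) := ⟨fun τ => τ, continuous_subtype_val⟩
  refine homotopic_of_weights huv hρ hσ ha' hb' (fun _ => 1 - id') (fun _ => id')
    (fun _ τ => sub_nonneg.2 τ.2.2) (fun _ τ => τ.2.1) (fun _ => sub_zero (1 : ℝ))
    (fun _ => sub_self (1 : ℝ)) (fun _ => rfl) (fun _ => rfl) (fun y τ => ?_)
    (fun i j τ _ _ => by omega) hd₀ hd₁
  rw [← finsum_mul, ← finsum_mul, ρ.sum_eq_one (mem_univ y), σ.sum_eq_one (mem_univ y), one_mul,
    one_mul]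
  exact sub_add_cancel _ _

/-- Maps into `B G` along which the universal cocycle has isomorphic pullbacks are homotopic. -/
theorem homotopic_of_iso_pullback {c₀ c₁ : C(Y, StasheffSpace G.toTopCategory)}
    (h : ((universalCocycle.{w} G).pullback c₀).Iso ((universalCocycle.{w} G).pullback c₁)) :
    c₀.Homotopic c₁ := by
  obtain ⟨ρ, hρ⟩ := isNumerable_universalCocycle.{w} G
  obtain ⟨r, hr, hrep⟩ := exists_homotopic_id hρ
  have key : ∀ c : C(Y, StasheffSpace G.toTopCategory), c.Homotopic (r.comp c) := fun c =>
    hr.comp (ContinuousMap.Homotopic.refl c)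
  obtain ⟨σ₀, hσ₀, e₀⟩ := PartitionOfUnity.exists_pullback ρ hρ c₀
  obtain ⟨σ₁, hσ₁, e₁⟩ := PartitionOfUnity.exists_pullback ρ hρ c₁
  refine (key c₀).trans (ContinuousMap.Homotopic.trans ?_ (key c₁).symm)
  exact homotopic_of_iso_of_represents h hσ₀ hσ₁ ULift.down_injective ULift.down_injective
    (fun y => (hrep (c₀ y)).comp e₀) fun y => (hrep (c₁ y)).comp e₁

end Homotopies

/-! ### The realization of the nerve of the unraveled category -/

section Unraveled

variable {O M : Type*} [TopologicalSpace O] [TopologicalSpace M] {G : TopGroupoid O M}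
  {k m : ℕ}

open StasheffSpace

theorem TopCategory.Composes.eq_of_right_one {C : TopCategory O M} {g h : M} {c : O}
    (H : C.Composes g (C.one c) h) : h = g := by
  have e : c = C.src g := (C.tgt_one c).symm.trans H.1.symm
  rw [e] at H
  exact H.unique (C.composes_one g)

theorem TopCategory.Composes.eq_of_left_one {C : TopCategory O M} {f h : M} {c : O}
    (H : C.Composes (C.one c) f h) : h = f := by
  have e : c = C.tgt f := (C.src_one c).symm.trans H.1
  rw [e] at H
  exact H.unique (C.one_composes f)

theorem TopGroupoid.inv_one (c : O) : G.inv (G.one c) = G.one c :=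
  (TopGroupoid.inv_left (f := G.one c) (h := G.one c) (by
    have := G.composes_one (G.one c)
    rwa [G.src_one] at this)).eq_of_right_one.symm

namespace Nerve

/-- The simplex of the nerve of `C` underlying a simplex of the nerve of the unraveled category. -/
def project {C : TopCategory O M} (F : Nerve (unraveled C) k) : Nerve C k :=
  ⟨fun p => (F.1 p).1.1,
    fun i => by
      obtain ⟨c, hc⟩ := F.2.1 i
      exact ⟨c.1, congrArg (fun x => x.1.1) hc⟩,
    fun i j l hij hjl => by
      obtain ⟨e, he⟩ := F.2.2 i j l hij hjl
      exact ⟨(Prod.ext_iff.1 e).1, congrArg (fun x => x.1.1) he⟩⟩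

theorem continuous_project {C : TopCategory O M} :
    Continuous (project : Nerve (unraveled C) k → Nerve C k) := by
  refine Continuous.subtype_mk (continuous_pi fun p => ?_) _
  exact continuous_fst.comp (continuous_subtype_val.comp
    ((continuous_apply p).comp continuous_subtype_val))

theorem continuous_restrict {C : TopCategory O M} (θ : Fin (m + 1) →o Fin (k + 1)) :
    Continuous fun F : Nerve C k => F.restrict θ :=
  Continuous.subtype_mk (continuous_pi fun p => (continuous_apply
    (⟨(θ p.1.1, θ p.1.2), θ.monotone p.2⟩ : {p : Fin (k + 1) × Fin (k + 1) // p.1 ≤ p.2})).comp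
      continuous_subtype_val) _

/-- The numbers of the ends of a morphism of a simplex are those of the identities at its
vertices. -/
theorem hom_labels {C : TopCategory O M} (F : Nerve (unraveled C) k) (i j : Fin (k + 1))
    (h : i ≤ j) : (F.hom i j h).1.2 =
      ((F.hom i i le_rfl).1.2.1, (F.hom j j le_rfl).1.2.1) := by
  obtain ⟨e, -⟩ := F.2.2 i i j le_rfl h
  obtain ⟨e', -⟩ := F.2.2 i j j h le_rfl
  obtain ⟨c, hc⟩ := F.2.1 i
  have h1 : (F.hom i j h).1.2.1 = (F.hom i i le_rfl).1.2.2 := (Prod.ext_iff.1 e).2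
  have h2 : (F.hom j j le_rfl).1.2.1 = (F.hom i j h).1.2.2 := (Prod.ext_iff.1 e').2
  have h3 : (F.hom i i le_rfl).1.2.2 = (F.hom i i le_rfl).1.2.1 := by
    change (F.1 ⟨(i, i), le_rfl⟩).1.2.2 = (F.1 ⟨(i, i), le_rfl⟩).1.2.1
    rw [hc]
    rfl
  exact Prod.ext (h1.trans h3) h2.symm

/-- The natural numbers `i₀ ≤ ⋯ ≤ i_k` of the vertices `(c_j, i_j)` of a simplex of the nerve of the
unraveled category. -/
def label {C : TopCategory O M} (F : Nerve (unraveled C) k) : Fin (k + 1) →o ℕ where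
  toFun i := (F.hom i i le_rfl).1.2.1
  monotone' i j h := by
    have := (F.hom i j h).2.1
    rwa [hom_labels F i j h] at this

theorem continuous_label {C : TopCategory O M} (i : Fin (k + 1)) :
    Continuous fun F : Nerve (unraveled C) k => F.label i :=
  continuous_fst.comp (continuous_snd.comp (continuous_subtype_val.comp
    ((continuous_apply _).comp continuous_subtype_val)))

theorem ext_project {C : TopCategory O M} {F F' : Nerve (unraveled C) k}
    (h : F.project = F'.project) (h' : ∀ i, F.label i = F'.label i) : F = F' := by
  refine Subtype.ext (funext fun p => Subtype.ext (Prod.ext ?_ ?_))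
  · exact congrFun (congrArg Subtype.val h) p
  · refine (hom_labels F _ _ p.2).trans (Eq.trans ?_ (hom_labels F' _ _ p.2).symm)
    exact Prod.ext (h' _) (h' _)

theorem exists_project_hom_eq_one {C : TopCategory O M} (F : Nerve (unraveled C) k)
    {i j : Fin (k + 1)} (h : i ≤ j) (hij : F.label i = F.label j) :
    ∃ c, F.project.hom i j h = C.one c :=
  (F.hom i j h).2.2 (by rw [hom_labels F i j h]; exact hij)

theorem exists_project_trans_eq_one (F : Nerve (unraveled G.toTopCategory) k) {i j : Fin (k + 1)}
    (hij : F.label i = F.label j) : ∃ c, F.project.trans i j = G.one c := by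
  rcases le_total i j with h | h
  · rw [trans_of_le _ h]
    exact F.exists_project_hom_eq_one h hij
  · obtain ⟨c, hc⟩ := F.exists_project_hom_eq_one h hij.symm
    exact ⟨c, by rw [trans_symm, trans_of_le _ h, hc, TopGroupoid.inv_one]⟩

/-- The morphism between two vertices of a simplex of the unraveled category depends only on their
labels. -/
theorem project_trans_congr (F : Nerve (unraveled G.toTopCategory) k) {i i' j j' : Fin (k + 1)}
    (hi : F.label i = F.label i') (hj : F.label j = F.label j') :
    F.project.trans i j = F.project.trans i' j' := by
  obtain ⟨c, hc⟩ := F.exists_project_trans_eq_one hi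
  obtain ⟨d, hd⟩ := F.exists_project_trans_eq_one hj
  have h1 := F.project.composes_trans i i' j'
  have h2 := F.project.composes_trans i j j'
  rw [hc] at h1
  rw [hd] at h2
  exact h2.eq_of_left_one.symm.trans h1.eq_of_right_one

end Nerve

/-- A monotone sequence of natural numbers is a strictly increasing sequence with repetitions. -/
theorem exists_factorization (a : Fin (k + 1) →o ℕ) :
    ∃ (m : ℕ) (α : Fin (m + 1) ↪o ℕ) (σ : Fin (m + 1) →o Fin (k + 1))
      (θ : Fin (k + 1) →o Fin (m + 1)), (∀ j, a (σ j) = α j) ∧ ∀ i, α (θ i) = a i := by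
  obtain ⟨m, hm⟩ : ∃ m, (Finset.univ.image a).card = m + 1 :=
    Nat.exists_eq_succ_of_ne_zero (Finset.card_ne_zero.2 (Finset.univ_nonempty.image a))
  let α := (Finset.univ.image a).orderEmbOfFin hm
  have h1 : ∀ j, ∃ i, a i = α j := fun j => by
    simpa only [Finset.mem_image, Finset.mem_univ, true_and] using
      Finset.orderEmbOfFin_mem (Finset.univ.image a) hm j
  have h2 : ∀ i, ∃ j, α j = a i := fun i => by
    have : a i ∈ range α := by
      rw [Finset.range_orderEmbOfFin]
      exact Finset.mem_image_of_mem a (Finset.mem_univ i)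
    exact this
  choose σ hσ using h1
  choose θ hθ using h2
  refine ⟨m, α, ⟨σ, fun j l h => ?_⟩, ⟨θ, fun i j h => ?_⟩, hσ, hθ⟩
  · by_contra! h'
    have h2 := a.monotone h'.le
    rw [hσ, hσ, α.le_iff_le] at h2
    rw [le_antisymm h h2] at h'
    exact lt_irrefl _ h'
  · rw [← α.le_iff_le, hθ, hθ]
    exact a.monotone h

theorem sum_ite_map {k m : ℕ} (θ : Fin (m + 1) → Fin (k + 1)) (t : stdSimplex ℝ (Fin (m + 1)))
    (P : Fin (k + 1) → Prop) [DecidablePred P] :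
    (∑ i, if P i then stdSimplex.map θ t i else 0) = ∑ l, if P (θ l) then t l else 0 := by
  rw [← Finset.sum_fiberwise (s := Finset.univ) (g := θ)]
  refine Finset.sum_congr rfl fun i _ => ?_
  rw [stdSimplex.map_coe, FunOnFinite.linearMap_apply_apply]
  split_ifs with h
  · refine Finset.sum_congr rfl fun l hl => ?_
    rw [(Finset.mem_filter.1 hl).2, if_pos h]
  · refine (Finset.sum_eq_zero fun l hl => ?_).symm
    rw [(Finset.mem_filter.1 hl).2, if_neg h]

/-- The point `p` of `B G` has the same barycentric coordinates and transition morphisms as the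
point `(F, t)` of the realization of the nerve of the unraveled category. -/
structure Corresponds (F : Nerve (unraveled G.toTopCategory) k) (t : stdSimplex ℝ (Fin (k + 1)))
    (p : StasheffSpace G.toTopCategory) : Prop where
  coord_eq : ∀ n, coord n p = ∑ i, if F.label i = n then t i else 0
  transition_eq : ∀ i j, coord (F.label i) p ≠ 0 → coord (F.label j) p ≠ 0 →
    transition (F.label i) (F.label j) p = F.project.trans i j

namespace Corresponds

variable {F : Nerve (unraveled G.toTopCategory) k} {t : stdSimplex ℝ (Fin (k + 1))}

theorem unique {p q : StasheffSpace G.toTopCategory} (hp : Corresponds F t p)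
    (hq : Corresponds F t q) : p = q := by
  have h : ∀ n, coord n p = coord n q := fun n => (hp.coord_eq n).trans (hq.coord_eq n).symm
  have ex : ∀ n, coord n p ≠ 0 → ∃ i, F.label i = n := by
    intro n hn
    by_contra! h'
    rw [hp.coord_eq] at hn
    exact hn (Finset.sum_eq_zero fun i _ => if_neg (h' i))
  refine ext_transition h fun m n hm hn => ?_
  obtain ⟨i, rfl⟩ := ex m hm
  obtain ⟨j, rfl⟩ := ex n hn
  rw [hp.transition_eq i j hm hn, hq.transition_eq i j (h _ ▸ hm) (h _ ▸ hn)]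

theorem of_factorization {α : Fin (m + 1) ↪o ℕ} {σ : Fin (m + 1) →o Fin (k + 1)}
    {θ : Fin (k + 1) →o Fin (m + 1)} (hσ : ∀ j, F.label (σ j) = α j)
    (hθ : ∀ i, α (θ i) = F.label i) :
    Corresponds F t (StasheffSpace.mk α (F.project.restrict σ) (stdSimplex.map θ t)) := by
  refine ⟨fun n => ?_, fun i j hi hj => ?_⟩
  · simp only [coord_mk, sum_ite_map, hθ]
  · rw [← hθ i, ← hθ j] at *
    rw [coord_mk_apply] at hi hj
    rw [transition_mk_apply _ _ _ hi hj, Nerve.restrict_trans]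
    exact F.project_trans_congr (by rw [hσ, hθ]) (by rw [hσ, hθ])

theorem restrict {F : Nerve (unraveled G.toTopCategory) k} {t : stdSimplex ℝ (Fin (m + 1))}
    {θ : Fin (m + 1) →o Fin (k + 1)} {p : StasheffSpace G.toTopCategory}
    (h : Corresponds F (stdSimplex.map θ t) p) : Corresponds (F.restrict θ) t p :=
  ⟨fun n => (h.coord_eq n).trans (sum_ite_map θ t _), fun i j hi hj =>
    (h.transition_eq (θ i) (θ j) hi hj).trans (F.project.restrict_trans θ i j).symm⟩

theorem unravel (α : Fin (k + 1) ↪o ℕ) (F : Nerve G.toTopCategory k)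
    (t : stdSimplex ℝ (Fin (k + 1))) : Corresponds (F.unravel α) t (StasheffSpace.mk α F t) := by
  refine ⟨fun n => rfl, fun i j hi hj => ?_⟩
  have hi : coord (α i) (StasheffSpace.mk α F t) ≠ 0 := hi
  have hj : coord (α j) (StasheffSpace.mk α F t) ≠ 0 := hj
  rw [coord_mk_apply] at hi hj
  exact transition_mk_apply α F t hi hj

theorem exists_point (F : Nerve (unraveled G.toTopCategory) k) (t : stdSimplex ℝ (Fin (k + 1))) :
    ∃ p, Corresponds F t p := by
  obtain ⟨m, α, σ, θ, hσ, hθ⟩ := exists_factorization F.label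
  exact ⟨_, of_factorization hσ hθ⟩

end Corresponds

namespace StasheffSpace

/-- The map `B G → |Ner G^ℕ|`. -/
def toRealization (p : StasheffSpace G.toTopCategory) :
    Realization (unraveled G.toTopCategory) :=
  Quot.lift (fun p : PreStasheff G.toTopCategory => Realization.mk (p.2.1.unravel p.1.2) p.2.2) (by
    rintro _ _ ⟨k, α, F, j, t⟩
    exact Quot.sound (RealizationRel.op (Fin.succAboveOrderEmb j).toOrderHom (F.unravel α) t)) p

theorem continuous_toRealization :
    Continuous (toRealization : StasheffSpace G.toTopCategory → _) := by
  refine continuous_of_mk fun k α => ?_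
  have h : Continuous fun F : Nerve G.toTopCategory k => F.unravel α :=
    Continuous.subtype_mk (continuous_pi fun p => Continuous.subtype_mk
      (((continuous_apply p).comp continuous_subtype_val).prodMk continuous_const) _) _
  exact continuous_quot_mk.comp ((continuous_sigmaMk (σ := fun k : ℕ =>
    Nerve (unraveled G.toTopCategory) k × stdSimplex ℝ (Fin (k + 1))) (i := k)).comp
      ((h.comp continuous_fst).prodMk continuous_snd))

end StasheffSpace

namespace Realization

/-- The map `|Ner G^ℕ| → B G`, which omits the repetitions among the labels of a simplex. -/
def toStasheff (x : Realization (unraveled G.toTopCategory)) : StasheffSpace G.toTopCategory :=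
  Quot.lift (fun x : (Σ k : ℕ, Nerve (unraveled G.toTopCategory) k × stdSimplex ℝ (Fin (k + 1))) =>
    (Corresponds.exists_point x.2.1 x.2.2).choose) (by
    rintro _ _ ⟨θ, F, t⟩
    exact (Corresponds.exists_point _ _).choose_spec.restrict.unique
      (Corresponds.exists_point _ _).choose_spec) x

theorem corresponds_toStasheff (F : Nerve (unraveled G.toTopCategory) k)
    (t : stdSimplex ℝ (Fin (k + 1))) : Corresponds F t (toStasheff (Realization.mk F t)) :=
  (Corresponds.exists_point F t).choose_spec

/-- The labels are locally constant on the nerve, and for fixed labels the map is given by a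
simplicial operator. -/
theorem continuous_toStasheff :
    Continuous (toStasheff : Realization (unraveled G.toTopCategory) → _) := by
  refine isQuotientMap_quot_mk.continuous_iff.2 (continuous_sigma fun k => ?_)
  rw [continuous_iff_continuousAt]
  rintro ⟨F, t⟩
  obtain ⟨m, α, σ, θ, hσ, hθ⟩ := exists_factorization F.label
  have ho : IsOpen {F' : Nerve (unraveled G.toTopCategory) k | ∀ i, F'.label i = F.label i} := by
    rw [ofPred_forall]
    exact isOpen_iInter_of_finite fun i =>
      (Nerve.continuous_label i).isOpen_preimage {F.label i} (isOpen_discrete _)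
  have hc : Continuous fun q : Nerve (unraveled G.toTopCategory) k × stdSimplex ℝ (Fin (k + 1)) =>
      StasheffSpace.mk α (q.1.project.restrict σ) (stdSimplex.map θ q.2) :=
    (continuous_mk α).comp ((((Nerve.continuous_restrict σ).comp Nerve.continuous_project).comp
      continuous_fst).prodMk ((stdSimplex.continuous_map θ).comp continuous_snd))
  refine hc.continuousAt.congr ?_
  filter_upwards [(ho.preimage continuous_fst).mem_nhds fun i => rfl] with q hq
  exact (Corresponds.of_factorization (fun j => (hq _).trans (hσ j))
    fun i => (hθ i).trans (hq i).symm).unique (corresponds_toStasheff q.1 q.2)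

end Realization

/-- Stasheff's classifying space is homeomorphic to the realization of the nerve of the unraveled
category. -/
def stasheffHomeomorph (G : TopGroupoid O M) :
    StasheffSpace G.toTopCategory ≃ₜ Realization (unraveled G.toTopCategory) where
  toFun := toRealization
  invFun := Realization.toStasheff
  left_inv p := by
    obtain ⟨k, α, F, t, rfl⟩ := exists_mk p
    exact (Realization.corresponds_toStasheff _ _).unique (Corresponds.unravel α F t)
  right_inv x := by
    obtain ⟨⟨k, F, t⟩, rfl⟩ := Quot.exists_rep x
    obtain ⟨m, α, σ, θ, hσ, hθ⟩ := exists_factorization F.label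
    have h : Realization.toStasheff (Quot.mk _ ⟨k, F, t⟩) =
        StasheffSpace.mk α (F.project.restrict σ) (stdSimplex.map θ t) :=
      (Realization.corresponds_toStasheff F t).unique (Corresponds.of_factorization hσ hθ)
    have h' : ((F.project.restrict σ).unravel α).restrict θ = F := by
      refine Nerve.ext_project (Nerve.ext_trans fun i j => ?_) hθ
      refine ((F.project.restrict σ).restrict_trans θ i j).trans ?_
      rw [Nerve.restrict_trans]
      exact F.project_trans_congr (by rw [hσ, hθ]) (by rw [hσ, hθ])
    rw [h]
    -- the given simplex is the degeneracy along `θ` of the one with repetitions omitted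
    refine (Quot.sound (RealizationRel.op θ ((F.project.restrict σ).unravel α) t)).trans ?_
    rw [h']
  continuous_toFun := continuous_toRealization
  continuous_invFun := Realization.continuous_toStasheff

end Unraveled

/-! ### The classification of numerable structures -/

section Classification

variable {O M : Type*} [TopologicalSpace O] [TopologicalSpace M]

/-- The numerable structure on `B G` given by the universal cocycle. -/
def universalStructure (G : TopGroupoid O M) :
    NumerableStructure.{w} G (StasheffSpace G.toTopCategory) :=
  Quotient.mk _ ⟨ULift.{w} ℕ, universalCocycle G, isNumerable_universalCocycle G⟩

/-- The map `[X, B G] → G_nu(X)`, `[c] ↦ [c^* γ]`. -/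
def classOfMap (G : TopGroupoid O M) (X : Type u) [TopologicalSpace X] :
    MapHomotopyClass X (StasheffSpace G.toTopCategory) → NumerableHomotopyClass.{w} G X :=
  Quotient.lift (fun c => NumerableHomotopyClass.mk ((universalCocycle.{w} G).pullback c)
    ((isNumerable_universalCocycle G).pullback c)) (by
    rintro c₀ c₁ ⟨H⟩
    let C : C(X × unitInterval, StasheffSpace G.toTopCategory) :=
      H.toContinuousMap.comp ⟨Prod.swap, continuous_swap⟩
    have h₀ : C.comp (slice X 0) = c₀ := ContinuousMap.ext fun x => H.map_zero_left x
    have h₁ : C.comp (slice X 1) = c₁ := ContinuousMap.ext fun x => H.map_one_left x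
    refine Quotient.sound ⟨(universalStructure G).pullback C, ?_, ?_⟩
    · rw [NumerableStructure.pullback_pullback, h₀]
      rfl
    · rw [NumerableStructure.pullback_pullback, h₁]
      rfl)

theorem NumerableStructure.exists_eq_pullback {G : TopGroupoid O M} {X : Type u}
    [TopologicalSpace X] (s : NumerableStructure.{w} G X) :
    ∃ c : C(X, StasheffSpace G.toTopCategory), s = (universalStructure G).pullback c := by
  obtain ⟨u, rfl⟩ := Quotient.exists_rep s
  obtain ⟨c, hc⟩ := u.isNumerable.exists_iso_pullback
  exact ⟨c, Quotient.sound hc⟩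

theorem bijective_classOfMap (G : TopGroupoid O M) (X : Type u) [TopologicalSpace X] :
    Function.Bijective (classOfMap.{w} G X) := by
  constructor
  · intro a b
    obtain ⟨c₀, rfl⟩ := Quotient.exists_rep a
    obtain ⟨c₁, rfl⟩ := Quotient.exists_rep b
    intro h
    obtain ⟨W, h₀, h₁⟩ := Quotient.exact h
    obtain ⟨C, rfl⟩ := W.exists_eq_pullback
    rw [NumerableStructure.pullback_pullback] at h₀ h₁
    refine Quotient.sound ((homotopic_of_iso_pullback (Quotient.exact h₀)).symm.trans ?_)
    refine ContinuousMap.Homotopic.trans ?_ (homotopic_of_iso_pullback (Quotient.exact h₁))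
    exact homotopic_of_slice C (fun _ => rfl) fun _ => rfl
  · intro s
    obtain ⟨s, rfl⟩ := Quotient.exists_rep s
    obtain ⟨c, rfl⟩ := s.exists_eq_pullback
    exact ⟨MapHomotopyClass.mk c, rfl⟩

end Classification

end StasheffClassification

end

theorem mainTheorem3 {O M : Type*} [TopologicalSpace O]
    [TopologicalSpace M] (G : TopGroupoid O M) :
    (∃ h : StasheffSpace G.toTopCategory ≃ₜ
          Realization
            (unraveled G.toTopCategory),
        ∀ (k : ℕ) (α : Fin (k + 1) ↪o ℕ)
          (F : Nerve G.toTopCategory k)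
          (t : stdSimplex ℝ (Fin (k + 1))),
          h (StasheffSpace.mk α F t) =
            Realization.mk (F.unravel α) t) ∧
    ∃ γ : Cocycle G
        (StasheffSpace G.toTopCategory) (ULift.{w} ℕ),
      IsUniversalCocycle γ ∧
      ∃ hγ : γ.IsNumerable,
        ∀ (X : Type u) [TopologicalSpace X],
          ∃ Φ : MapHomotopyClass X
                (StasheffSpace G.toTopCategory) ≃
              NumerableHomotopyClass.{w} G X,
            (∀ c : C(X, StasheffSpace G.toTopCategory),
              Φ (MapHomotopyClass.mk c) =
                NumerableHomotopyClass.mk (γ.pullback c)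
                  (hγ.pullback c)) ∧
            ∀ (ι : Type w) (u : Cocycle G X ι) (e : ι ↪ ℕ)
              (ρ : PartitionOfUnity ι X Set.univ) (hρ : ρ.IsSubordinate u.U),
              ∃ c : C(X, StasheffSpace G.toTopCategory),
                IsClassifyingMap u ρ e c ∧
                Φ.symm (NumerableHomotopyClass.mk u ⟨ρ, hρ⟩) =
                  MapHomotopyClass.mk c := by
  refine ⟨⟨stasheffHomeomorph G, fun _ _ _ _ => rfl⟩, universalCocycle G,
    isUniversalCocycle_universalCocycle G, isNumerable_universalCocycle G, fun X _ => ?_⟩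
  refine ⟨Equiv.ofBijective _ (bijective_classOfMap G X), fun _ => rfl, fun ι u e ρ hρ => ?_⟩
  have hv : IsColouring ρ e := fun _ _ _ _ _ h => e.injective h
  obtain ⟨c, hc⟩ := exists_classifyingMap hρ hv
  refine ⟨c, isClassifyingMap_of_represents hρ hc, ?_⟩
  rw [Equiv.symm_apply_eq]
  exact congrArg (Quotient.mk _) (Quotient.sound (iso_pullback_universalCocycle hρ hv hc))
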